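/- **Definitions.** For a topological space $X$ let $\mathcal B(X)$ be the set of formal barycenters $\sum t_ix_i$ (finite sums, $x_i\in X$, $t_i\ge 0$, $\sum t_i=1$, where terms with $t_i=0$ are dropped and coefficients of equal points are added), with the finest topology for which all maps $\Delta^{k-1}\times X^k\to\mathcal B(X)$, $(t,x)\mapsto\sum t_ix_i$, are continuous. For an integer $n\ge 0$ let $\mathcal B_n(X)\subset\mathcal B(X)$ be the subspace of barycenters of at most $n$ points, so $\mathcal B_0(X)=\emptyset$. Given two distinct points $p_1,p_2\in X$ with weights $w_1,w_2$, put $w(p_i)=w_i$ and $w(x)=1$ for $x\ne p_1,p_2$, and for $\rho>0$ let $$\mathcal B_\rho^{Q_2}(X)=\Big\{\sum t_ix_i\in\mathcal B(X)\ \Big|\ \sum_{i} w(x_i)\le\rho\Big\}$$ with the subspace topology, where the $x_i$ are distinct and have nonzero coefficients. $\Sigma$ denotes the unreduced suspension, with $\Sigma\emptyset=S^0$. A point $p\in X$ is called nondegenerate if $(X,\{p\})$ is an NDR-pair: there are a continuous $f:X\to[0,1]$ with $f^{-1}(0)=\{p\}$ and a homotopy $h:X\times[0,1]\to X$ with $h(x,0)=x$,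 $h(p,t)=p$, and $h(x,1)=p$ whenever $f(x)<1$. (For example, every point of a CW complex or of a topological manifold is nondegenerate.) **Proposition.** Let $X$ be a connected Hausdorff space, $p_1\neq p_2$ points of $X$ with weights $0<w_1\le w_2\le 1$, let $\rho>0$, and write $\rho=n+\varepsilon$ with $n=\lfloor\rho\rfloor$ and $0\le\varepsilon<1$. In (2) and (4) assume moreover that $X$ is path-connected and that $p_1,p_2$ are nondegenerate points; there $X\vee S^1$ is formed at an arbitrary base point $x_0\in X$. Then the following five cases exhaust all possibilities, and in each of them $\mathcal B_\rho^{Q_2}(X)$ has the stated homotopy type: 1. if $w_1+w_2\le\varepsilon$, then $\mathcal B_\rho^{Q_2}(X)$ is contractible; 2. if $w_1\le\varepsilon$, $w_2\le\varepsilon$ and $w_1+w_2>\varepsilon$, then $\mathcal B_\rho^{Q_2}(X)\simeq\Sigma\mathcal B_n(X\vee S^1)$; 3. if $w_1\le\varepsilon$ and $w_2>\varepsilon$, then $\mathcal B_\rho^{Q_2}(X)$ is contractible; 4. if $w_1>\varepsilon$, $w_2>\varepsilon$ and $w_1+w_2\le 1+\varepsilon$, then $\mathcal B_\rho^{Q_2}(X)\simeq\mathcal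 B_n(X\vee S^1)$; 5. if $w_1+w_2>1+\varepsilon$, then $\mathcal B_\rho^{Q_2}(X)\simeq\mathcal B_n(X)$. -/

import Mathlib

open Topology ContinuousMap

noncomputable section

universe u v

/-- The set of formal barycenters on `X`: finite formal sums `∑ tᵢ xᵢ` with `tᵢ ≥ 0` and
`∑ tᵢ = 1`, where terms with coefficient `0` are dropped and the coefficients of equal points are
added.  Such a sum is the same thing as a finitely supported function `X → ℝ` with nonnegative
values and total mass `1`; the points that occur in it are the elements of its support. -/
def FormalBary (X : Type u) : Type u :=
  {μ : X →₀ ℝ // (∀ x, 0 ≤ μ x) ∧ μ.sum (fun _ t => t) = 1}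

namespace FormalBary

/-- The formal barycenter `∑ i, tᵢ xᵢ` of `n` (not necessarily distinct) points. -/
def mk {X : Type u} (n : ℕ) (q : stdSimplex ℝ (Fin n) × (Fin n → X)) : FormalBary X :=
  ⟨∑ i, Finsupp.single (q.2 i) ((q.1 : Fin n → ℝ) i), by
    constructor
    · intro x
      rw [Finsupp.finsetSum_apply]
      refine Finset.sum_nonneg fun i _ => ?_
      classical
      rw [Finsupp.single_apply]
      split_ifs
      · exact q.1.2.1 i
      · exact le_rfl
    · rw [← Finsupp.sum_finsetSum_index (fun _ => rfl) (fun _ _ _ => rfl)]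
      simp⟩

/-- The topology on the space of all formal barycenters: the finest one for which all maps
`Δ^{n-1} × X^n → FormalBary X`, `(t, x) ↦ ∑ tᵢ xᵢ`, are continuous.  Equivalently, the direct limit
of the spaces of barycenters of `n` points, each with its quotient topology from
`Δ^{n-1} × X^n`. -/
instance {X : Type u} [TopologicalSpace X] : TopologicalSpace (FormalBary X) :=
  ⨆ n : ℕ, TopologicalSpace.coinduced (mk (X := X) n) inferInstance

/-- The finite set of points that occur (with nonzero coefficient) in a formal barycenter. -/
def points {X : Type u} (μ : FormalBary X) : Finset X := μ.1.support

end FormalBary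

/-- `B_n(X)`: the formal barycenters of at most `n` points, a subspace of the space of all formal
barycenters.  It is empty for `n = 0`. -/
def barySpace (X : Type u) (n : ℕ) : Set (FormalBary X) :=
  {μ | μ.points.card ≤ n}

/-- The formal barycenters of total weight at most `ρ` for the weight function `w`, as a subspace
of the space of all formal barycenters. -/
def weightedBarySpace {X : Type u} (w : X → ℝ) (ρ : ℝ) : Set (FormalBary X) :=
  {μ | ∑ x ∈ μ.points, w x ≤ ρ}

open Classical in
/-- The weight function with singular points `p₁`, `p₂` of weights `w₁`, `w₂`; all other points
have weight `1`. -/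
def twoPointWeight {X : Type u} (p₁ p₂ : X) (w₁ w₂ : ℝ) (x : X) : ℝ :=
  if x = p₁ then w₁ else if x = p₂ then w₂ else 1

/-- The one-point union `X ∨ Y`: the disjoint union with `x₀` and `y₀` identified. -/
def Wedge {X : Type u} {Y : Type v} (x₀ : X) (y₀ : Y) : Type (max u v) :=
  Quot (fun a b : X ⊕ Y => a = Sum.inl x₀ ∧ b = Sum.inr y₀)

instance {X : Type u} {Y : Type v} [TopologicalSpace X] [TopologicalSpace Y] (x₀ : X) (y₀ : Y) :
    TopologicalSpace (Wedge x₀ y₀) :=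
  inferInstanceAs (TopologicalSpace (Quot _))

/-- The identifications in the suspension: one end of the cylinder `D × [0,1]` is glued to
one pole, the other end to the other pole. -/
inductive SuspensionRel (D : Type u) : (D × unitInterval) ⊕ Bool → (D × unitInterval) ⊕ Bool → Prop
  | south (d : D) : SuspensionRel D (Sum.inl (d, 0)) (Sum.inr false)
  | north (d : D) : SuspensionRel D (Sum.inl (d, 1)) (Sum.inr true)

/-- The unreduced suspension `ΣD = S⁰ * D`.  The suspension of the empty space is `S⁰`. -/
def Suspension (D : Type u) : Type u := Quot (SuspensionRel D)

instance {D : Type u} [TopologicalSpace D] : TopologicalSpace (Suspension D) :=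
  inferInstanceAs (TopologicalSpace (Quot _))

/-- `p` is a nondegenerate point of `X`: the pair `(X, {p})` is an NDR-pair. -/
def IsNondegeneratePoint {X : Type u} [TopologicalSpace X] (p : X) : Prop :=
  ∃ (f : C(X, unitInterval)) (h : C(X × unitInterval, X)),
    (∀ x, f x = 0 ↔ x = p) ∧ (∀ x, h (x, 0) = x) ∧ (∀ t, h (p, t) = p) ∧
      ∀ x, f x < 1 → h (x, 1) = p

end

/-!
All maps between spaces of barycenters that occur here are restrictions of maps `𝓑(X) → 𝓑(Y)`
defined on all barycenters. They are built from affine extensions `∑ tᵢ xᵢ ↦ ∑ tᵢ K(xᵢ)`, convex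
combinations, and multiplication of the coefficients by a positive continuous function followed by
normalization. Such maps lift to the spaces `Δ^{k-1} × X^k` (`FormalBary.Liftable`), and
multiplication with a locally compact parameter space preserves quotient maps, so that continuity of
maps and homotopies is checked on the lifts (`FormalBary.continuous_of_mk`); no compactness of `X`
and no product of two spaces of barycenters is involved.

Counting the points of a barycenter other than `p₁` and `p₂` shows which sets of points have weight
at most `ρ = n + ε`. If `w₁ + w₂ ≤ ε` or `w₁ ≤ ε < w₂`, then `p₁` may be added to any such set, and
line segments to `p₁` contract the space. If `1 + ε < w₁ + w₂`, then the space is `𝓑ₙ(X)` itself.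

If `ε < w₁, w₂` and `w₁ + w₂ ≤ 1 + ε`, then `p₁` and `p₂` together count as one point
(`fiberBarySpace`). Let `E` be `X` with an arc from `p₁` to `p₂` attached. A point of the arc can be
split into masses at `p₁` and `p₂`, which gives a map from `𝓑ₙ(E)`. In the other direction, use that
`p₁` is nondegenerate to collapse a neighbourhood of `p₁` and spread it over the arc, so that the
images of `p₁` and `p₂` agree; this maps the space to `𝓑ₙ(E)`. The two maps are homotopy inverse to
each other (`PairCollapse.fiberBarySpaceEquiv`), and `E ≃ X ∨ S¹` since the ends of the arc can be
moved along paths (`ArcAttach.slideEquiv`, `ArcAttach.wedgeCircle`).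

If `w₁, w₂ ≤ ε < w₁ + w₂`, then the space (`pairBarySpace`) is the union of two subspaces that are
star-shaped about `p₁` and `p₂` and intersect in the space `D` of the previous paragraph. The line
segments give a map from the suspension of `D`. For its homotopy inverse
(`PairCollapse.toSuspension`), collapse neighbourhoods of both points and remove an amount of the mass
near `p₁` and `p₂` that depends on the masses `a` and `b` near these points; the difference `b - a`
is the suspension coordinate, and the poles are used when `|a - b| ≥ 1 / 2`. The removal is
complete when `a` or `b` vanishes, which is what is needed for the result to lie in `D`; when
both are positive, the collapsed barycenter already lies in `D`.
-/

noncomputable section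

/-! ### Formal barycenters as finitely supported functions -/

namespace FormalBary

variable {X Y Z T : Type*}

theorem ext_val {μ ν : FormalBary X} (h : μ.1 = ν.1) : μ = ν := Subtype.ext h

theorem linearCombination_linearCombination {M : Type*} [AddCommMonoid M] [Module ℝ M]
    (f : X → Y →₀ ℝ) (g : Y → M) (m : X →₀ ℝ) :
    Finsupp.linearCombination ℝ g (Finsupp.linearCombination ℝ f m) =
      Finsupp.linearCombination ℝ (fun x => Finsupp.linearCombination ℝ g (f x)) m := by
  rw [Finsupp.linearCombination_apply ℝ m, Finsupp.linearCombination_apply ℝ m,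
    Finsupp.sum, Finsupp.sum, map_sum]
  simp only [map_smul]

/-- The integral `∑ tᵢ g(xᵢ)` of a function against a formal barycenter. -/
def integral (μ : FormalBary X) (g : X → ℝ) : ℝ := Finsupp.linearCombination ℝ g μ.1

theorem integral_eq_sum (μ : FormalBary X) (g : X → ℝ) :
    μ.integral g = ∑ x ∈ μ.points, μ.1 x * g x := rfl

theorem mass_eq_linearCombination (m : X →₀ ℝ) :
    m.sum (fun _ t => t) = Finsupp.linearCombination ℝ (fun _ : X => (1 : ℝ)) m := by
  simp [Finsupp.linearCombination_apply]

theorem integral_one (μ : FormalBary X) : μ.integral (fun _ => 1) = 1 := by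
  rw [integral, ← mass_eq_linearCombination]; exact μ.2.2

theorem pos_of_mem_points {μ : FormalBary X} {x : X} (hx : x ∈ μ.points) : 0 < μ.1 x :=
  lt_of_le_of_ne (μ.2.1 x) (Ne.symm (Finsupp.mem_support_iff.1 hx))

theorem integral_nonneg (μ : FormalBary X) {g : X → ℝ} (hg : ∀ x, 0 ≤ g x) :
    0 ≤ μ.integral g :=
  Finset.sum_nonneg fun x _ => mul_nonneg (μ.2.1 x) (hg x)

theorem integral_mono (μ : FormalBary X) {g g' : X → ℝ} (h : ∀ x, g x ≤ g' x) :
    μ.integral g ≤ μ.integral g' :=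
  Finset.sum_le_sum fun x _ => mul_le_mul_of_nonneg_left (h x) (μ.2.1 x)

theorem integral_eq_zero_iff (μ : FormalBary X) {g : X → ℝ} (hg : ∀ x, 0 ≤ g x) :
    μ.integral g = 0 ↔ ∀ x ∈ μ.points, g x = 0 := by
  rw [integral_eq_sum, Finset.sum_eq_zero_iff_of_nonneg fun x _ => mul_nonneg (μ.2.1 x) (hg x)]
  refine forall₂_congr fun x hx => ?_
  simp [(pos_of_mem_points hx).ne']

theorem integral_add (μ : FormalBary X) (g g' : X → ℝ) :
    μ.integral (fun x => g x + g' x) = μ.integral g + μ.integral g' := by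
  simp only [integral_eq_sum, mul_add, Finset.sum_add_distrib]

theorem integral_one_sub_mul (μ : FormalBary X) (c : ℝ) (g : X → ℝ) :
    μ.integral (fun x => 1 - c * g x) = 1 - c * μ.integral g := by
  have h := μ.integral_one
  simp only [integral_eq_sum, mul_sub, Finset.sum_sub_distrib] at h ⊢
  rw [h, Finset.mul_sum]
  congr 1
  exact Finset.sum_congr rfl fun x _ => by ring

/-- The barycenter concentrated at one point. -/
def dirac (x : X) : FormalBary X :=
  ⟨Finsupp.single x 1, fun y => by
    classical
    rw [Finsupp.single_apply]; split_ifs <;> norm_num, by simp⟩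

@[simp] theorem points_dirac (x : X) : (dirac x).points = {x} :=
  Finsupp.support_single _ one_ne_zero

@[simp] theorem integral_dirac (x : X) (g : X → ℝ) : (dirac x).integral g = g x := by
  simp [integral, dirac]

/-- The barycenter `∑ tᵢ K(xᵢ)` obtained from `∑ tᵢ xᵢ` and a map `K` from points to
barycenters: the affine extension of `K`. -/
def bind (μ : FormalBary X) (K : X → FormalBary Y) : FormalBary Y :=
  ⟨Finsupp.linearCombination ℝ (fun x => (K x).1) μ.1, by
    constructor
    · intro y
      rw [Finsupp.linearCombination_apply, Finsupp.sum, Finsupp.finsetSum_apply]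
      exact Finset.sum_nonneg fun x _ => mul_nonneg (μ.2.1 x) ((K x).2.1 y)
    · have h : ∀ x, Finsupp.linearCombination ℝ (fun _ : Y => (1 : ℝ)) (K x).1 = 1 :=
        fun x => (K x).integral_one
      rw [mass_eq_linearCombination, linearCombination_linearCombination]
      simp only [h]
      exact μ.integral_one⟩

theorem points_bind_subset [DecidableEq Y] (μ : FormalBary X) (K : X → FormalBary Y) :
    (μ.bind K).points ⊆ μ.points.biUnion fun x => (K x).points := by
  refine (Finsupp.support_sum).trans (Finset.biUnion_mono fun x _ => ?_)
  exact Finsupp.support_smul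

@[simp] theorem bind_dirac (μ : FormalBary X) : μ.bind dirac = μ := by
  apply ext_val
  change Finsupp.linearCombination ℝ (fun x : X => Finsupp.single x (1 : ℝ)) μ.1 = _
  simp [Finsupp.linearCombination_apply]

theorem bind_bind (μ : FormalBary X) (K : X → FormalBary Y) (L : Y → FormalBary Z) :
    (μ.bind K).bind L = μ.bind fun x => (K x).bind L := by
  exact ext_val (linearCombination_linearCombination _ _ _)

@[simp] theorem dirac_bind (x : X) (K : X → FormalBary Y) : (dirac x).bind K = K x := by
  apply ext_val; simp [bind, dirac]

/-- The convex combination `(1 - c) μ + c ν`. -/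
def mix (c : unitInterval) (μ ν : FormalBary X) : FormalBary X :=
  ⟨(1 - c : ℝ) • μ.1 + (c : ℝ) • ν.1, by
    constructor
    · intro x
      exact add_nonneg (mul_nonneg (sub_nonneg.2 c.2.2) (μ.2.1 x)) (mul_nonneg c.2.1 (ν.2.1 x))
    · rw [mass_eq_linearCombination, map_add, map_smul, map_smul]
      have h : ∀ μ : FormalBary X, Finsupp.linearCombination ℝ (fun _ : X => (1 : ℝ)) μ.1 = 1 :=
        fun μ => μ.integral_one
      rw [h, h]; simp⟩

@[simp] theorem mix_zero (μ ν : FormalBary X) : mix 0 μ ν = μ := by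
  apply ext_val; simp [mix]

@[simp] theorem mix_one (μ ν : FormalBary X) : mix 1 μ ν = ν := by
  apply ext_val; simp [mix]

@[simp] theorem mix_self (c : unitInterval) (μ : FormalBary X) : mix c μ μ = μ := by
  apply ext_val; simp [mix, ← add_smul]

theorem points_mix_subset [DecidableEq X] (c : unitInterval) (μ ν : FormalBary X) :
    (mix c μ ν).points ⊆ μ.points ∪ ν.points :=
  Finsupp.support_add.trans
    (Finset.union_subset_union Finsupp.support_smul Finsupp.support_smul)

/-- The barycenter obtained by multiplying each coefficient `tᵢ` by `g(xᵢ)` and normalizing. -/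
def reweight (μ : FormalBary X) (g : X → ℝ) (hg : ∀ x, 0 ≤ g x) (h : 0 < μ.integral g) :
    FormalBary X :=
  ⟨(μ.integral g)⁻¹ • Finsupp.linearCombination ℝ (fun x => Finsupp.single x (g x)) μ.1, by
    constructor
    · intro x
      rw [Finsupp.linearCombination_apply, Finsupp.sum, Finsupp.smul_apply,
        Finsupp.finsetSum_apply]
      refine mul_nonneg (inv_nonneg.2 h.le) (Finset.sum_nonneg fun y _ => ?_)
      refine mul_nonneg (μ.2.1 y) ?_
      classical
      rw [Finsupp.single_apply]; split_ifs; exacts [hg y, le_rfl]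
    · rw [mass_eq_linearCombination, map_smul, linearCombination_linearCombination]
      simp only [Finsupp.linearCombination_single, smul_eq_mul, mul_one]
      exact inv_mul_cancel₀ h.ne'⟩

theorem points_reweight_subset (μ : FormalBary X) (g : X → ℝ) (hg : ∀ x, 0 ≤ g x)
    (h : 0 < μ.integral g) {x : X} (hx : x ∈ (μ.reweight g hg h).points) :
    x ∈ μ.points ∧ g x ≠ 0 := by
  classical
  have h1 := Finsupp.support_sum (Finsupp.support_smul hx)
  obtain ⟨y, hy, hxy⟩ := Finset.mem_biUnion.1 h1
  have h2 := Finsupp.support_smul hxy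
  have h3 := Finset.mem_singleton.1 (Finsupp.support_single_subset h2)
  subst h3
  refine ⟨hy, fun h0 => ?_⟩
  simp [h0] at h2

theorem exists_mk_eq (μ : FormalBary X) : ∃ k q, mk k q = μ := by
  let e := μ.points.equivFin
  refine ⟨μ.points.card, (⟨fun i => μ.1 (e.symm i), fun i => μ.2.1 _, ?_⟩,
    fun i => (e.symm i : X)), ?_⟩
  · rw [e.symm.sum_comp (fun x : μ.points => μ.1 x), Finset.sum_coe_sort μ.points μ.1]
    exact μ.2.2
  · apply ext_val
    change ∑ i, Finsupp.single (e.symm i : X) (μ.1 (e.symm i)) = _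
    rw [e.symm.sum_comp (fun x : μ.points => Finsupp.single (x : X) (μ.1 x)),
      Finset.sum_coe_sort μ.points fun x => Finsupp.single x (μ.1 x)]
    exact μ.1.sum_single

/-! ### Liftable families of barycenters and continuity -/

variable [TopologicalSpace X] [TopologicalSpace Y] [TopologicalSpace Z] [TopologicalSpace T]

theorem continuous_mk (k : ℕ) : Continuous (mk (X := X) k) :=
  continuous_iff_coinduced_le.2 (le_iSup (fun k => TopologicalSpace.coinduced (mk (X := X) k)
    inferInstance) k)

theorem isQuotientMap_sigma_mk :
    IsQuotientMap fun q : (k : ℕ) × (stdSimplex ℝ (Fin k) × (Fin k → X)) => mk q.1 q.2 := by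
  refine (isQuotientMap_iff _).2 ⟨isCoinducing_iff.2 fun s => ?_, fun μ => ?_⟩
  swap
  · obtain ⟨k, q, h⟩ := exists_mk_eq μ
    exact ⟨⟨k, q⟩, h⟩
  · rw [isOpen_sigma_iff]
    change _ ↔ IsOpen[⨆ k, TopologicalSpace.coinduced (mk (X := X) k) inferInstance] s
    rw [isOpen_iSup_iff]
    rfl

/-- Continuity of maps out of `T × 𝓑(X)` can be tested on the simplices `T × Δ^{k-1} × X^k`. Local
compactness of `T` makes `T × -` preserve the quotient map onto `𝓑(X)`. -/
theorem continuous_of_mk [LocallyCompactSpace T] {Φ : T × FormalBary X → Z}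
    (h : ∀ k, Continuous fun z : T × (stdSimplex ℝ (Fin k) × (Fin k → X)) =>
      Φ (z.1, mk k z.2)) : Continuous Φ := by
  refine (isQuotientMap_sigma_mk (X := X)).continuous_lift_prod_right ?_
  have : Continuous fun z : ((k : ℕ) × (stdSimplex ℝ (Fin k) × (Fin k → X))) × T =>
      Φ (z.2, mk z.1.1 z.1.2) := by
    rw [← Homeomorph.sigmaProdDistrib.symm.comp_continuous_iff', continuous_sigma_iff]
    intro k
    exact (h k).comp continuous_swap
  exact this.comp continuous_swap

theorem continuous_of_mk_right {Φ : FormalBary X → Z}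
    (h : ∀ k, Continuous fun q : stdSimplex ℝ (Fin k) × (Fin k → X) => Φ (mk k q)) :
    Continuous Φ :=
  (isQuotientMap_sigma_mk (X := X)).continuous_iff.2 (continuous_sigma h)

/-- A family of barycenters is liftable if it can be written as `z ↦ ∑ tᵢ(z) xᵢ(z)` with
finitely many continuous coefficients and continuous points. -/
def Liftable (F : Z → FormalBary X) : Prop :=
  ∃ (ι : Type) (_ : Fintype ι) (t : ι → Z → ℝ) (x : ι → Z → X),
    (∀ i, Continuous (t i)) ∧ (∀ i, Continuous (x i)) ∧ (∀ i z, 0 ≤ t i z) ∧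
      ∀ z, (F z).1 = ∑ i, Finsupp.single (x i z) (t i z)

theorem Liftable.continuous {F : Z → FormalBary X} (hF : Liftable F) : Continuous F := by
  obtain ⟨ι, _, t, x, ht, hx, ht0, h⟩ := hF
  let e := Fintype.equivFin ι
  have hs : ∀ z, ∑ j, t (e.symm j) z = 1 := fun z => by
    have := (F z).2.2
    rw [mass_eq_linearCombination, h, map_sum] at this
    rw [e.symm.sum_comp fun i => t i z]
    simpa using this
  let q : Z → stdSimplex ℝ (Fin (Fintype.card ι)) × (Fin (Fintype.card ι) → X) := fun z =>
    (⟨fun j => t (e.symm j) z, fun j => ht0 _ z, hs z⟩, fun j => x (e.symm j) z)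
  have hq : Continuous q :=
    (Continuous.subtype_mk (continuous_pi fun j => ht _) _).prodMk (continuous_pi fun j => hx _)
  have : F = mk _ ∘ q := by
    funext z
    apply ext_val
    rw [h]
    exact (e.symm.sum_comp fun i => Finsupp.single (x i z) (t i z)).symm
  rw [this]
  exact (continuous_mk _).comp hq

theorem liftable_mk (k : ℕ) : Liftable (mk (X := X) k) :=
  ⟨Fin k, inferInstance, fun i q => q.1 i, fun i q => q.2 i,
    fun i => (continuous_apply i).comp (continuous_subtype_val.comp continuous_fst),
    fun i => (continuous_apply i).comp continuous_snd, fun i q => q.1.2.1 i, fun _ => rfl⟩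

theorem liftable_dirac {f : Z → X} (hf : Continuous f) : Liftable fun z => dirac (f z) :=
  ⟨Unit, inferInstance, fun _ _ => 1, fun _ => f, fun _ => continuous_const, fun _ => hf,
    fun _ _ => zero_le_one, fun _ => by simp [dirac]⟩

theorem Liftable.comp {F : Z → FormalBary X} (hF : Liftable F) {f : T → Z} (hf : Continuous f) :
    Liftable fun w => F (f w) := by
  obtain ⟨ι, _, t, x, ht, hx, ht0, h⟩ := hF
  exact ⟨ι, inferInstance, fun i w => t i (f w), fun i w => x i (f w), fun i => (ht i).comp hf,
    fun i => (hx i).comp hf, fun i w => ht0 i _, fun w => h _⟩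

theorem Liftable.mix {F G : Z → FormalBary X} (hF : Liftable F) (hG : Liftable G)
    {c : Z → unitInterval} (hc : Continuous c) : Liftable fun z => mix (c z) (F z) (G z) := by
  obtain ⟨ι, _, t, x, ht, hx, ht0, h⟩ := hF
  obtain ⟨ι', _, t', x', ht', hx', ht0', h'⟩ := hG
  have hc' : Continuous fun z => (c z : ℝ) := continuous_subtype_val.comp hc
  refine ⟨ι ⊕ ι', inferInstance,
    fun i z => i.elim (fun i => (1 - c z) * t i z) (fun i => c z * t' i z),
    fun i z => i.elim (fun i => x i z) (fun i => x' i z), ?_, ?_, ?_, ?_⟩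
  · rintro (i | i)
    exacts [(continuous_const.sub hc').mul (ht i), hc'.mul (ht' i)]
  · rintro (i | i)
    exacts [hx i, hx' i]
  · rintro (i | i) z
    exacts [mul_nonneg (sub_nonneg.2 (c z).2.2) (ht0 i z), mul_nonneg (c z).2.1 (ht0' i z)]
  · intro z
    simp [FormalBary.mix, h, h', Finset.smul_sum, Fintype.sum_sum_type]

theorem Liftable.integral_continuous {F : Z → FormalBary X} (hF : Liftable F) {g : Z → X → ℝ}
    (hg : Continuous (Function.uncurry g)) : Continuous fun z => (F z).integral (g z) := by
  obtain ⟨ι, _, t, x, ht, hx, ht0, h⟩ := hF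
  have : (fun z => (F z).integral (g z)) = fun z => ∑ i, t i z * g z (x i z) := by
    funext z
    simp [integral, h]
  rw [this]
  exact continuous_finsetSum _ fun i _ =>
    (ht i).mul (hg.comp (continuous_id.prodMk (hx i)))

theorem Liftable.bind {F : Z → FormalBary X} (hF : Liftable F) {K : Z → X → FormalBary Y}
    (hK : Liftable (Function.uncurry K)) : Liftable fun z => (F z).bind (K z) := by
  obtain ⟨ι, _, t, x, ht, hx, ht0, h⟩ := hF
  obtain ⟨ι', _, t', x', ht', hx', ht0', h'⟩ := hK
  have hc : ∀ i, Continuous fun z => (z, x i z) := fun i => continuous_id.prodMk (hx i)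
  refine ⟨ι × ι', inferInstance, fun i z => t i.1 z * t' i.2 (z, x i.1 z),
    fun i z => x' i.2 (z, x i.1 z), fun i => (ht _).mul ((ht' _).comp (hc _)),
    fun i => (hx' _).comp (hc _), fun i z => mul_nonneg (ht0 _ _) (ht0' _ _), fun z => ?_⟩
  have h'' : ∀ y, (K z y).1 = ∑ i, Finsupp.single (x' i (z, y)) (t' i (z, y)) :=
    fun y => h' (z, y)
  simp [FormalBary.bind, h, h'', Finset.smul_sum, Fintype.sum_prod_type]

theorem Liftable.reweight {F : Z → FormalBary X} (hF : Liftable F) {g : Z → X → ℝ}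
    (hgc : Continuous (Function.uncurry g)) (hg : ∀ z x, 0 ≤ g z x)
    (hpos : ∀ z, 0 < (F z).integral (g z)) :
    Liftable fun z => (F z).reweight (g z) (hg z) (hpos z) := by
  have hI := hF.integral_continuous hgc
  obtain ⟨ι, _, t, x, ht, hx, ht0, h⟩ := hF
  refine ⟨ι, inferInstance, fun i z => ((F z).integral (g z))⁻¹ * (t i z * g z (x i z)), x,
    fun i => (hI.inv₀ fun z => (hpos z).ne').mul
      ((ht i).mul (hgc.comp (continuous_id.prodMk (hx i)))), hx,
    fun i z => mul_nonneg (inv_nonneg.2 (hpos z).le) (mul_nonneg (ht0 i z) (hg _ _)),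
    fun z => ?_⟩
  simp only [FormalBary.reweight, h, map_sum, Finsupp.linearCombination_single, Finset.smul_sum,
    Finsupp.smul_single, smul_eq_mul]

theorem continuous_integral {g : X → ℝ} (hg : Continuous g) :
    Continuous fun μ : FormalBary X => μ.integral g :=
  continuous_of_mk_right fun k => (liftable_mk k).integral_continuous
    (g := fun _ => g) (hg.comp continuous_snd)

theorem continuous_bind [LocallyCompactSpace T] {K : T → X → FormalBary Y}
    (hK : Liftable (Function.uncurry K)) :
    Continuous fun z : T × FormalBary X => z.2.bind (K z.1) :=
  continuous_of_mk fun k => (((liftable_mk k).comp continuous_snd).bind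
    (K := fun z => K z.1) (hK.comp
      ((continuous_fst.comp continuous_fst).prodMk continuous_snd))).continuous

end FormalBary

/-! ### Homotopies between restricted maps -/

/-- A continuous map that sends `S` into `T`, restricted to a map of subspaces. -/
def restrictSub {A B : Type*} [TopologicalSpace A] [TopologicalSpace B] {S : Set A} {T : Set B}
    (f : A → B) (hf : Continuous f) (h : Set.MapsTo f S T) : C(S, T) :=
  ⟨h.restrict f S T, hf.restrict h⟩

theorem homotopic_of_global {A B : Type*} [TopologicalSpace A] [TopologicalSpace B] {S : Set A}
    {T : Set B} {f g : C(S, T)} (Φ : unitInterval × A → B) (hΦ : Continuous Φ)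
    (hm : ∀ t, ∀ a ∈ S, Φ (t, a) ∈ T) (h0 : ∀ a : S, Φ (0, a) = f a)
    (h1 : ∀ a : S, Φ (1, a) = g a) : f.Homotopic g :=
  ⟨⟨⟨fun z => ⟨Φ (z.1, z.2), hm z.1 z.2 z.2.2⟩,
    (hΦ.comp (continuous_fst.prodMk (continuous_subtype_val.comp continuous_snd))).subtype_mk _⟩,
    fun a => Subtype.ext (h0 a), fun a => Subtype.ext (h1 a)⟩⟩

/-! ### Affine maps between spaces of barycenters -/

open Classical in
/-- The barycenters whose points lie in at most `n` fibres of `π`. -/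
def fiberBarySpace {X A : Type*} (π : X → A) (n : ℕ) : Set (FormalBary X) :=
  {μ | (μ.points.image π).card ≤ n}

theorem fiberBarySpace_id {X : Type*} (n : ℕ) : fiberBarySpace (id : X → X) n = barySpace X n := by
  ext μ; simp [fiberBarySpace, barySpace]

/-- An affine extension maps `fiberBarySpace π n` to `fiberBarySpace ρ n` if the points of `K x` lie
in a single fibre of `ρ`, which only depends on `π x`. -/
theorem bind_mem_fiberBarySpace {X Y A B : Type*} {π : X → A} {ρ : Y → B} {n : ℕ}
    {K : X → FormalBary Y} (κ : A → B) (hK : ∀ x, ∀ y ∈ (K x).points, ρ y = κ (π x))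
    {μ : FormalBary X} (hμ : μ ∈ fiberBarySpace π n) : μ.bind K ∈ fiberBarySpace ρ n := by
  classical
  refine le_trans ?_ (Finset.card_image_le.trans hμ : ((μ.points.image π).image κ).card ≤ n)
  refine Finset.card_le_card fun b hb => ?_
  obtain ⟨y, hy, rfl⟩ := Finset.mem_image.1 hb
  obtain ⟨x, hx, hxy⟩ := Finset.mem_biUnion.1 (FormalBary.points_bind_subset μ K hy)
  exact Finset.mem_image.2 ⟨π x, Finset.mem_image_of_mem _ hx, (hK x y hxy).symm⟩

theorem continuous_bind_dirac {X Y T : Type*} [TopologicalSpace X] [TopologicalSpace Y]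
    [TopologicalSpace T] [LocallyCompactSpace T] {f : T × X → Y} (hf : Continuous f) :
    Continuous fun z : T × FormalBary X => z.2.bind fun x => FormalBary.dirac (f (z.1, x)) :=
  FormalBary.continuous_bind (K := fun t x => FormalBary.dirac (f (t, x)))
    (FormalBary.liftable_dirac hf)

theorem continuous_map_dirac {X Y : Type*} [TopologicalSpace X] [TopologicalSpace Y] {f : X → Y}
    (hf : Continuous f) :
    Continuous fun μ : FormalBary X => μ.bind fun x => FormalBary.dirac (f x) :=
  (continuous_bind_dirac (T := Unit) (hf.comp continuous_snd)).comp (Continuous.prodMk_right ())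

/-- The map `∑ tᵢ xᵢ ↦ ∑ tᵢ f(xᵢ)` on barycenters of at most `n` points. -/
def barySpaceMap {X Y : Type*} [TopologicalSpace X] [TopologicalSpace Y] (f : C(X, Y)) (n : ℕ) :
    C(barySpace X n, barySpace Y n) :=
  restrictSub (fun μ => μ.bind fun x => FormalBary.dirac (f x))
    (continuous_map_dirac f.continuous)
    fun μ hμ => by
      rw [← fiberBarySpace_id] at hμ ⊢
      exact bind_mem_fiberBarySpace f (by simp) hμ

theorem barySpaceMap_homotopic {X Y : Type*} [TopologicalSpace X] [TopologicalSpace Y]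
    {f g : C(X, Y)} (h : f.Homotopic g) (n : ℕ) :
    (barySpaceMap f n).Homotopic (barySpaceMap g n) := by
  obtain ⟨H⟩ := h
  refine homotopic_of_global _ (continuous_bind_dirac H.continuous) (fun t μ hμ => ?_)
    (fun μ => ?_) fun μ => ?_
  · rw [← fiberBarySpace_id] at hμ ⊢
    exact bind_mem_fiberBarySpace (fun x => H (t, x)) (by simp) hμ
  · change μ.1.bind (fun x => FormalBary.dirac (H (0, x))) =
      μ.1.bind fun x => FormalBary.dirac (f x)
    simp
  · change μ.1.bind (fun x => FormalBary.dirac (H (1, x))) =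
      μ.1.bind fun x => FormalBary.dirac (g x)
    simp

theorem barySpaceMap_comp {X Y Z : Type*} [TopologicalSpace X] [TopologicalSpace Y]
    [TopologicalSpace Z] (g : C(Y, Z)) (f : C(X, Y)) (n : ℕ) :
    (barySpaceMap g n).comp (barySpaceMap f n) = barySpaceMap (g.comp f) n := by
  ext1 μ
  refine Subtype.ext ((FormalBary.bind_bind _ _ _).trans ?_)
  change μ.1.bind _ = μ.1.bind _
  simp

theorem barySpaceMap_id {X : Type*} [TopologicalSpace X] (n : ℕ) :
    barySpaceMap (ContinuousMap.id X) n = ContinuousMap.id _ := by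
  ext1 μ
  exact Subtype.ext (FormalBary.bind_dirac _)

/-- A homotopy equivalence of spaces induces one of the spaces of barycenters. -/
def barySpaceEquiv {X Y : Type*} [TopologicalSpace X] [TopologicalSpace Y] (e : X ≃ₕ Y) (n : ℕ) :
    barySpace X n ≃ₕ barySpace Y n where
  toFun := barySpaceMap e.toFun n
  invFun := barySpaceMap e.invFun n
  left_inv := by
    rw [barySpaceMap_comp, ← barySpaceMap_id]; exact barySpaceMap_homotopic e.left_inv n
  right_inv := by
    rw [barySpaceMap_comp, ← barySpaceMap_id]; exact barySpaceMap_homotopic e.right_inv n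

/-- A subspace of barycenters that is star-shaped about a point is contractible. -/
theorem contractibleSpace_of_starShaped {X : Type*} [TopologicalSpace X] {S : Set (FormalBary X)}
    {p : X} (hp : FormalBary.dirac p ∈ S)
    (h : ∀ c, ∀ μ ∈ S, FormalBary.mix c μ (FormalBary.dirac p) ∈ S) : ContractibleSpace S := by
  rw [contractible_iff_id_nullhomotopic]
  refine ⟨⟨_, hp⟩, homotopic_of_global
    (fun z => FormalBary.mix z.1 z.2 (FormalBary.dirac p))
    (FormalBary.continuous_of_mk fun k => ?_) h ?_ ?_⟩
  · exact (((FormalBary.liftable_mk k).comp continuous_snd).mix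
      (FormalBary.liftable_dirac continuous_const) continuous_fst).continuous
  · simp
  · simp

/-! ### Suspensions -/

namespace Suspension

variable {D D' T V : Type*} [TopologicalSpace D] [TopologicalSpace D'] [TopologicalSpace T]
  [TopologicalSpace V]

/-- The pole of the suspension at the end `s = 0` (for `false`) or `s = 1` (for `true`). -/
def pole (D : Type*) (b : Bool) : Suspension D := Quot.mk _ (Sum.inr b)

/-- The point of the suspension at height `s` over `d`. -/
def point (d : D) (s : unitInterval) : Suspension D := Quot.mk _ (Sum.inl (d, s))

omit [TopologicalSpace D] in
@[simp] theorem point_zero (d : D) : point d 0 = pole D false := Quot.sound (.south d)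

omit [TopologicalSpace D] in
@[simp] theorem point_one (d : D) : point d 1 = pole D true := Quot.sound (.north d)

theorem continuous_point : Continuous fun z : D × unitInterval => point z.1 z.2 :=
  continuous_quot_mk.comp continuous_inl

theorem continuous_of_point [LocallyCompactSpace T] {Φ : T × Suspension D → V}
    (hs : Continuous fun z : T × (D × unitInterval) => Φ (z.1, point z.2.1 z.2.2))
    (hp : ∀ b, Continuous fun t : T => Φ (t, pole D b)) : Continuous Φ := by
  refine (isQuotientMap_quot_mk (r := SuspensionRel D)).continuous_lift_prod_right ?_
  rw [← Homeomorph.prodSumDistrib.symm.comp_continuous_iff', continuous_sum_dom]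
  refine ⟨hs, ?_⟩
  rw [← (Homeomorph.prodComm Bool T).comp_continuous_iff', continuous_prod_of_discrete_left]
  exact hp

/-- A map out of a suspension given by a map on the cylinder that is constant on the ends. -/
def lift (g : D × unitInterval → V) (v : Bool → V) (h0 : ∀ d, g (d, 0) = v false)
    (h1 : ∀ d, g (d, 1) = v true) : Suspension D → V :=
  Quot.lift (Sum.elim g v) (by rintro _ _ (d | d); exacts [h0 d, h1 d])

theorem continuous_lift {g : D × unitInterval → V} (hg : Continuous g) {v : Bool → V}
    (h0 : ∀ d, g (d, 0) = v false) (h1 : ∀ d, g (d, 1) = v true) : Continuous (lift g v h0 h1) :=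
  continuous_quot_lift _ (hg.sumElim continuous_of_discreteTopology)

/-- The suspension of a map. -/
def map (f : C(D, D')) : C(Suspension D, Suspension D') :=
  ⟨lift (fun z => point (f z.1) z.2) (pole D') (by simp) (by simp),
    continuous_lift (continuous_point.comp (f.continuous.prodMap continuous_id)) _ _⟩

theorem map_homotopic {f g : C(D, D')} (h : f.Homotopic g) : (map f).Homotopic (map g) := by
  obtain ⟨H⟩ := h
  refine ⟨⟨⟨fun z => lift (fun w => point (H (z.1, w.1)) w.2) (pole D') (by simp) (by simp) z.2,
    continuous_of_point ?_ fun b => continuous_const⟩, ?_, ?_⟩⟩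
  · exact continuous_point.comp ((H.continuous.comp (continuous_fst.prodMk
      (continuous_fst.comp continuous_snd))).prodMk (continuous_snd.comp continuous_snd))
  · rintro ⟨⟨d, s⟩ | b⟩
    · exact congrArg (point · s) (H.apply_zero d)
    · rfl
  · rintro ⟨⟨d, s⟩ | b⟩
    · exact congrArg (point · s) (H.apply_one d)
    · rfl

/-- Suspensions of homotopy equivalent spaces are homotopy equivalent. -/
def equiv (e : D ≃ₕ D') : Suspension D ≃ₕ Suspension D' where
  toFun := map e.toFun
  invFun := map e.invFun
  left_inv := by
    convert map_homotopic e.left_inv using 1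
    · refine ContinuousMap.ext ?_; rintro ⟨⟨d, s⟩ | b⟩ <;> rfl
    · refine ContinuousMap.ext ?_; rintro ⟨⟨d, s⟩ | b⟩ <;> rfl
  right_inv := by
    convert map_homotopic e.right_inv using 1
    · refine ContinuousMap.ext ?_; rintro ⟨⟨d, s⟩ | b⟩ <;> rfl
    · refine ContinuousMap.ext ?_; rintro ⟨⟨d, s⟩ | b⟩ <;> rfl

end Suspension

/-! ### Attaching an arc -/

/-- The identifications that glue the ends of an arc to `p` and `q`. -/
inductive ArcRel {X : Type*} (p q : X) : X ⊕ unitInterval → X ⊕ unitInterval → Prop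
  | source : ArcRel p q (Sum.inl p) (Sum.inr 0)
  | target : ArcRel p q (Sum.inl q) (Sum.inr 1)

/-- The space `X` with an arc from `p` to `q` attached. -/
def ArcAttach {X : Type*} (p q : X) : Type _ := Quot (ArcRel p q)

namespace ArcAttach

variable {X Y T : Type*} [TopologicalSpace X] [TopologicalSpace Y] [TopologicalSpace T]

instance (p q : X) : TopologicalSpace (ArcAttach p q) := inferInstanceAs (TopologicalSpace (Quot _))

/-- The inclusion of `X`. -/
def inc (p q : X) : C(X, ArcAttach p q) :=
  ⟨fun x => Quot.mk _ (Sum.inl x), continuous_quot_mk.comp continuous_inl⟩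

/-- The attached arc. -/
def arc (p q : X) : Path (inc p q p) (inc p q q) where
  toFun t := Quot.mk _ (Sum.inr t)
  continuous_toFun := continuous_quot_mk.comp continuous_inr
  source' := (Quot.sound .source).symm
  target' := (Quot.sound .target).symm

theorem ind {p q : X} {C : ArcAttach p q → Prop} (hX : ∀ x, C (inc p q x))
    (ha : ∀ t, C (arc p q t)) : ∀ z, C z := by
  rintro ⟨x | t⟩
  exacts [hX x, ha t]

theorem continuous_of_prod [LocallyCompactSpace T] {p q : X} {Φ : T × ArcAttach p q → Y}
    (hX : Continuous fun z : T × X => Φ (z.1, inc p q z.2))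
    (ha : Continuous fun z : T × unitInterval => Φ (z.1, arc p q z.2)) : Continuous Φ := by
  refine (isQuotientMap_quot_mk (r := ArcRel p q)).continuous_lift_prod_right ?_
  rw [← Homeomorph.prodSumDistrib.symm.comp_continuous_iff', continuous_sum_dom]
  exact ⟨hX, ha⟩

/-- The map out of `ArcAttach p q` given by a map `f` on `X` and a path from `f p` to `f q`. -/
def lift {p q : X} (f : C(X, Y)) (γ : Path (f p) (f q)) : C(ArcAttach p q, Y) :=
  ⟨Quot.lift (Sum.elim f γ) (by rintro _ _ (_ | _) <;> simp), continuous_quot_lift _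
    (f.continuous.sumElim γ.continuous)⟩

@[simp] theorem lift_inc {p q : X} (f : C(X, Y)) (γ : Path (f p) (f q)) (x : X) :
    lift f γ (inc p q x) = f x := rfl

@[simp] theorem lift_arc {p q : X} (f : C(X, Y)) (γ : Path (f p) (f q)) (t : unitInterval) :
    lift f γ (arc p q t) = γ t := rfl

theorem lift_homotopic {p q : X} (f : C(X, Y)) {γ γ' : Path (f p) (f q)} (h : γ.Homotopic γ') :
    (lift f γ).Homotopic (lift f γ') := by
  obtain ⟨H⟩ := h
  refine ⟨⟨⟨fun z => lift f (H.eval z.1) z.2, continuous_of_prod ?_ ?_⟩, ?_, ?_⟩⟩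
  · exact f.continuous.comp continuous_snd
  · exact H.continuous
  · intro z; simp
  · intro z; simp

theorem path_cancel {x y z w : X} (a : Path x y) (γ : Path x z) (b : Path z w) :
    ((a.trans ((a.symm.trans γ).trans b)).trans b.symm).Homotopic γ := by
  apply Path.Homotopic.Quotient.exact
  simp only [Path.Homotopic.Quotient.mk_trans, Path.Homotopic.Quotient.mk_symm]
  generalize Path.Homotopic.Quotient.mk a = a
  generalize Path.Homotopic.Quotient.mk b = b
  generalize Path.Homotopic.Quotient.mk γ = γ
  rw [Path.Homotopic.Quotient.trans_assoc a, Path.Homotopic.Quotient.trans_assoc _ b,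
    Path.Homotopic.Quotient.trans_symm, Path.Homotopic.Quotient.trans_refl,
    ← Path.Homotopic.Quotient.trans_assoc, Path.Homotopic.Quotient.trans_symm,
    Path.Homotopic.Quotient.refl_trans]

/-- Moving the ends of the attached arc along paths `α` and `β`. -/
def slide {p q p' q' : X} (α : Path p p') (β : Path q q') : C(ArcAttach p q, ArcAttach p' q') :=
  lift (inc p' q') (((α.map (inc p' q').continuous).trans (arc p' q')).trans
    (β.map (inc p' q').continuous).symm)

theorem slide_comp_slide {p q p' q' : X} (α : Path p p') (β : Path q q') :
    ((slide α.symm β.symm).comp (slide α β)).Homotopic (ContinuousMap.id _) := by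
  have h1 : (slide α.symm β.symm).comp (slide α β) = lift (inc p q)
      (((α.map (inc p q).continuous).trans ((((α.map (inc p q).continuous).symm).trans
        (arc p q)).trans (β.map (inc p q).continuous))).trans
          (β.map (inc p q).continuous).symm) := by
    refine ContinuousMap.ext (ind (fun x => ?_) fun t => ?_)
    · rfl
    change ((((α.map (inc p' q').continuous).trans (arc p' q')).trans
      (β.map (inc p' q').continuous).symm).map (slide α.symm β.symm).continuous) t = _
    have h : (β.symm.map (inc p q).continuous).symm = β.map (inc p q).continuous := by
      rw [← Path.map_symm, Path.symm_symm]
    have ha : (arc p' q').map (slide α.symm β.symm).continuous =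
        (((α.map (inc p q).continuous).symm).trans (arc p q)).trans
          (β.map (inc p q).continuous) := by
      rw [← h]; rfl
    rw [Path.map_trans, Path.map_trans, ha]
    rfl
  have h2 : ContinuousMap.id _ = lift (inc p q) (arc p q) := by
    refine ContinuousMap.ext (ind (fun x => ?_) fun t => ?_) <;> rfl
  rw [h1, h2]
  exact lift_homotopic _ (path_cancel _ _ _)

/-- Up to homotopy the result of attaching an arc to `X` only depends on the path components of the
endpoints. -/
def slideEquiv {p q p' q' : X} (α : Path p p') (β : Path q q') :
    ArcAttach p q ≃ₕ ArcAttach p' q' where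
  toFun := slide α β
  invFun := slide α.symm β.symm
  left_inv := slide_comp_slide α β
  right_inv := by simpa using slide_comp_slide α.symm β.symm

/-! ### One-point unions with a circle -/

/-- The standard parametrization of the circle by the unit interval. -/
def circleLoop : Path (1 : Circle) 1 where
  toFun t := Circle.exp (2 * Real.pi * t)
  source' := by simp
  target' := by simp

theorem isQuotientMap_circleLoop : IsQuotientMap circleLoop.toContinuousMap := by
  refine IsQuotientMap.of_surjective_continuous ?_ circleLoop.continuous
  intro z
  obtain ⟨x, rfl⟩ := Circle.exp_surjective z
  refine ⟨⟨Int.fract (x / (2 * Real.pi)), Int.fract_nonneg _, (Int.fract_lt_one _).le⟩,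
    Circle.exp_eq_exp.2 ⟨-⌊x / (2 * Real.pi)⌋, ?_⟩⟩
  have := Real.pi_pos
  simp only [Int.fract]
  push_cast
  field_simp
  ring

theorem arc_factorsThrough_circleLoop (x₀ : X) :
    Function.FactorsThrough (arc x₀ x₀).toContinuousMap circleLoop.toContinuousMap := by
  intro s t h
  obtain ⟨m, hm⟩ := Circle.exp_eq_exp.1
    (h : Circle.exp (2 * Real.pi * s) = Circle.exp (2 * Real.pi * t))
  have hst : (s : ℝ) = t + m :=
    mul_left_cancel₀ Real.two_pi_pos.ne' (by linear_combination hm)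
  have h0 : arc x₀ x₀ 0 = arc x₀ x₀ 1 := by simp
  have hs := s.2
  have ht := t.2
  have hm1 : m ≤ 1 := by
    have : (m : ℝ) ≤ 1 := by linarith [hs.2, ht.1]
    exact_mod_cast this
  have hm2 : -1 ≤ m := by
    have : (-1 : ℝ) ≤ m := by linarith [hs.1, ht.2]
    exact_mod_cast this
  change arc x₀ x₀ s = arc x₀ x₀ t
  interval_cases m
  · have h1 : s = 0 := Subtype.ext (by push_cast at hst ⊢; linarith [hs.1, ht.2])
    have h2 : t = 1 := Subtype.ext (by push_cast at hst ⊢; linarith [hs.1, ht.2])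
    rw [h1, h2, h0]
  · rw [show s = t from Subtype.ext (by simpa using hst)]
  · have h1 : s = 1 := Subtype.ext (by push_cast at hst ⊢; linarith [hs.2, ht.1])
    have h2 : t = 0 := Subtype.ext (by push_cast at hst ⊢; linarith [hs.2, ht.1])
    rw [h1, h2, h0]

/-- The one-point union `X ∨ S¹` is `X` with an arc attached at both ends to the base point. -/
def wedgeCircle (x₀ : X) : ArcAttach x₀ x₀ ≃ₜ Wedge x₀ (1 : Circle) where
  toFun := lift (Y := Wedge x₀ (1 : Circle))
    ⟨fun x => Quot.mk _ (Sum.inl x), continuous_quot_mk.comp continuous_inl⟩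
    ((circleLoop.map (f := fun z => (Quot.mk _ (Sum.inr z) : Wedge x₀ (1 : Circle)))
      (continuous_quot_mk.comp continuous_inr)).cast (Quot.sound ⟨rfl, rfl⟩)
      (Quot.sound ⟨rfl, rfl⟩))
  invFun := Quot.lift (Sum.elim (inc x₀ x₀)
    (isQuotientMap_circleLoop.lift _ (arc_factorsThrough_circleLoop x₀))) (by
      rintro _ _ ⟨rfl, rfl⟩
      have : isQuotientMap_circleLoop.lift _ (arc_factorsThrough_circleLoop x₀)
        (circleLoop 0) = arc x₀ x₀ 0 := DFunLike.congr_fun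
          (isQuotientMap_circleLoop.lift_comp _ (arc_factorsThrough_circleLoop x₀)) 0
      rw [circleLoop.source] at this
      simpa using this.symm)
  left_inv := ind (fun x => rfl) fun t => DFunLike.congr_fun
    (isQuotientMap_circleLoop.lift_comp _ (arc_factorsThrough_circleLoop x₀)) t
  right_inv := by
    rintro ⟨x | z⟩
    · rfl
    · obtain ⟨t, rfl⟩ := isQuotientMap_circleLoop.surjective z
      have := DFunLike.congr_fun
        (isQuotientMap_circleLoop.lift_comp _ (arc_factorsThrough_circleLoop x₀)) t
      exact congrArg (lift _ _) this
  continuous_toFun := ContinuousMap.continuous _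
  continuous_invFun := continuous_quot_lift _ ((inc x₀ x₀).continuous.sumElim
    (ContinuousMap.continuous _))

end ArcAttach

/-! ### Collapsing neighbourhoods of two nondegenerate points -/

/-- A deformation `H` of `X` that fixes `p` and `q` and ends with a map collapsing the
neighbourhood `{0 ≤ φ}` of `p` to `p` and the neighbourhood `{0 ≤ ψ}` of `q` to `q`. The functions
`φ` and `ψ` are at most `1`, with value `1` at `p` and `q` respectively. -/
structure PairCollapse {X : Type*} [TopologicalSpace X] (p q : X) where
  /-- The deformation. -/
  H : C(unitInterval × X, X)
  /-- The function that singles out a neighbourhood of `p`. -/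
  φ : C(X, ℝ)
  /-- The function that singles out a neighbourhood of `q`. -/
  ψ : C(X, ℝ)
  H_zero : ∀ x, H (0, x) = x
  H_left : ∀ t, H (t, p) = p
  H_right : ∀ t, H (t, q) = q
  φ_left : φ p = 1
  ψ_right : ψ q = 1
  φ_le_one : ∀ x, φ x ≤ 1
  ψ_le_one : ∀ x, ψ x ≤ 1
  H_one_of_φ : ∀ x, 0 ≤ φ x → H (1, x) = p
  H_one_of_ψ : ∀ x, 0 ≤ ψ x → H (1, x) = q

theorem exists_pairCollapse {X : Type*} [TopologicalSpace X] {p q : X} (hpq : p ≠ q)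
    (hp : IsNondegeneratePoint p) (hq : IsNondegeneratePoint q) :
    Nonempty (PairCollapse p q) := by
  obtain ⟨f, h, hf, h0, hfix, h1⟩ := hp
  obtain ⟨g, k, hg, k0, kfix, k1⟩ := hq
  have hfc : Continuous fun x => (f x : ℝ) := continuous_subtype_val.comp f.continuous
  have hgc : Continuous fun x => (g x : ℝ) := continuous_subtype_val.comp g.continuous
  have hpos : ∀ x, 0 < (f x : ℝ) + g x := by
    intro x
    rcases (f x).2.1.lt_or_eq with h | h
    · linarith [(g x).2.1]
    rcases (g x).2.1.lt_or_eq with h' | h'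
    · linarith
    exact absurd (((hf x).1 (Subtype.ext h.symm)).symm.trans ((hg x).1 (Subtype.ext h'.symm))) hpq
  -- `u` vanishes at `p`, equals `1` at `q`, and separates the supports of the two deformations.
  let u : X → ℝ := fun x => f x / (f x + g x)
  have hu : Continuous u := hfc.div (hfc.add hgc) fun x => (hpos x).ne'
  have hfp : (f p : ℝ) = 0 := by rw [(hf p).2 rfl]; rfl
  have hgq : (g q : ℝ) = 0 := by rw [(hg q).2 rfl]; rfl
  have hup : u p = 0 := by simp [u, hfp]
  have huq : u q = 1 := by
    have := hpos q
    simp only [u, hgq, add_zero] at this ⊢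
    exact div_self this.ne'
  have hu0 : ∀ x, 0 ≤ u x := fun x => div_nonneg (f x).2.1 (hpos x).le
  have hu1 : ∀ x, u x ≤ 1 := fun x => by
    rw [div_le_one (hpos x)]; linarith [(g x).2.1]
  let c : ℝ → unitInterval := Set.projIcc 0 1 zero_le_one
  have hc : Continuous c := continuous_projIcc
  let P : unitInterval × X → X := fun z =>
    if u z.2 ≤ 1 / 2 then h (z.2, z.1 * c (2 - 4 * u z.2)) else k (z.2, z.1 * c (4 * u z.2 - 2))
  have hP : Continuous P := by
    refine Continuous.if_le ?_ ?_ (hu.comp continuous_snd) continuous_const ?_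
    · exact h.continuous.comp (continuous_snd.prodMk (continuous_fst.mul (hc.comp
        (continuous_const.sub (continuous_const.mul (hu.comp continuous_snd))))))
    · exact k.continuous.comp (continuous_snd.prodMk (continuous_fst.mul (hc.comp
        ((continuous_const.mul (hu.comp continuous_snd)).sub continuous_const))))
    · intro z hz
      have h2 : c (2 - 4 * u z.2) = 0 := Set.projIcc_of_le_left _ (by rw [hz]; norm_num)
      have h3 : c (4 * u z.2 - 2) = 0 := Set.projIcc_of_le_left _ (by rw [hz]; norm_num)
      rw [h2, h3]; simp [h0, k0]
  refine ⟨⟨⟨P, hP⟩, ⟨fun x => 1 - 4 * max (f x : ℝ) (u x), by fun_prop⟩,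
    ⟨fun x => 1 - 4 * max (g x : ℝ) (1 - u x), by fun_prop⟩, ?_, ?_, ?_, ?_, ?_, ?_, ?_, ?_, ?_⟩⟩
  · intro x
    simp only [ContinuousMap.coe_mk, P]
    split_ifs <;> simp [h0, k0]
  · intro t
    simp [P, hup, hfix]
  · intro t
    have : ¬ ((1 : ℝ) ≤ 1 / 2) := by norm_num
    simp only [ContinuousMap.coe_mk, P, huq, if_neg this, kfix]
  · simp [hfp, hup]
  · simp [hgq, huq]
  · intro x
    have := (f x).2.1.trans (le_max_left _ (u x))
    change 1 - 4 * max (f x : ℝ) (u x) ≤ 1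
    linarith
  · intro x
    have := (g x).2.1.trans (le_max_left _ (1 - u x))
    change 1 - 4 * max (g x : ℝ) (1 - u x) ≤ 1
    linarith
  · intro x hx
    change 0 ≤ 1 - 4 * max (f x : ℝ) (u x) at hx
    have h2 := le_max_left (f x : ℝ) (u x)
    have h3 := le_max_right (f x : ℝ) (u x)
    have h4 : c (2 - 4 * u x) = 1 := Set.projIcc_of_right_le _ (by linarith)
    simp only [ContinuousMap.coe_mk, P]
    rw [if_pos (by linarith), h4, mul_one]
    exact h1 x (Subtype.coe_lt_coe.1 (by change (f x : ℝ) < 1; linarith))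
  · intro x hx
    change 0 ≤ 1 - 4 * max (g x : ℝ) (1 - u x) at hx
    have h2 := le_max_left (g x : ℝ) (1 - u x)
    have h3 := le_max_right (g x : ℝ) (1 - u x)
    have h4 : c (4 * u x - 2) = 1 := Set.projIcc_of_right_le _ (by linarith)
    simp only [ContinuousMap.coe_mk, P]
    rw [if_neg (by linarith), h4, mul_one]
    exact k1 x (Subtype.coe_lt_coe.1 (by change (g x : ℝ) < 1; linarith))

/-! ### Identifying two points of the support -/

open Classical in
/-- The map that identifies `q` with `p`. -/
def mergePoint {X : Type*} (p q x : X) : X := if x = q then p else x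

section mergePoint

variable {X : Type*} {p q : X}

@[simp] theorem mergePoint_left : mergePoint p q p = p := by simp [mergePoint]

@[simp] theorem mergePoint_right : mergePoint p q q = p := by simp [mergePoint]

theorem comp_mergePoint {Y : Type*} {f : X → Y} (h : f p = f q) (x : X) :
    f (mergePoint p q x) = f x := by
  unfold mergePoint; split_ifs with hx
  · rw [hx, h]
  · rfl

end mergePoint

theorem FormalBary.bind_eq_of_forall {X Y : Type*} {μ : FormalBary X} {K : X → FormalBary Y}
    {ν : FormalBary Y} (h : ∀ x ∈ μ.points, K x = ν) : μ.bind K = ν := by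
  apply ext_val
  change ∑ x ∈ μ.points, μ.1 x • (K x).1 = ν.1
  rw [Finset.sum_congr rfl fun x hx => by rw [h x hx], ← Finset.sum_smul]
  have := μ.integral_one
  simp only [integral_eq_sum, mul_one] at this
  rw [this, one_smul]

namespace ArcAttach

variable {X : Type*} [TopologicalSpace X] {p q : X}

/-- The path that runs through `γ` during the time interval `[a / 4, (a + 1) / 4]`. -/
def quarterPath (γ : Path p q) (a : ℝ) (h0 : 0 ≤ a) (h1 : a ≤ 3) : Path p q where
  toFun t := γ (Set.projIcc 0 1 zero_le_one (4 * t - a))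
  continuous_toFun := γ.continuous.comp (continuous_projIcc.comp (by fun_prop))
  source' := by rw [Set.projIcc_of_le_left _ (by simpa using h0)]; exact γ.source
  target' := by
    rw [Set.projIcc_of_right_le _ (by simp only [Set.Icc.coe_one]; linarith)]; exact γ.target

/-- The coefficient of the second point in `segmentMap`. -/
def segmentCoeff (p q : X) : C(ArcAttach p q, unitInterval) :=
  lift (ContinuousMap.const X 0)
    { toFun := fun t : unitInterval =>
        Set.projIcc 0 1 zero_le_one (min (4 * (t : ℝ) - 1) (4 - 4 * t))
      continuous_toFun := continuous_projIcc.comp (by fun_prop)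
      source' := Set.projIcc_of_le_left _ (by simp)
      target' := Set.projIcc_of_le_left _ (by simp) }

/-- The map that is `x ↦ x` on `X` and sends the attached arc onto the segment between `p`
and `q` in the space of barycenters. A path `γ` from `p` to `q` in `X` is used to write it
globally as a convex combination of two continuous maps to `X`: over the four quarters of
the arc, in turn, the second point moves from `p` to `q` with coefficient `0`, its coefficient
grows from `0` to `1`, the first point moves from `p` to `q` with coefficient `0`, and the
coefficient of the second point returns to `0` while both points are `q`. -/
def segmentMap (γ : Path p q) (z : ArcAttach p q) : FormalBary X :=
  FormalBary.mix (segmentCoeff p q z)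
    (FormalBary.dirac (lift (ContinuousMap.id X) (quarterPath γ 2 (by norm_num) (by norm_num)) z))
    (FormalBary.dirac (lift (ContinuousMap.id X) (quarterPath γ 0 (by norm_num) (by norm_num)) z))

theorem liftable_segmentMap (γ : Path p q) : FormalBary.Liftable (segmentMap γ) :=
  (FormalBary.liftable_dirac (ContinuousMap.continuous _)).mix
    (FormalBary.liftable_dirac (ContinuousMap.continuous _)) (ContinuousMap.continuous _)

@[simp] theorem segmentMap_inc (γ : Path p q) (x : X) :
    segmentMap γ (inc p q x) = FormalBary.dirac x :=
  FormalBary.mix_zero _ _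

theorem points_segmentMap_arc (γ : Path p q) (t : unitInterval) :
    ∀ x ∈ (segmentMap γ (arc p q t)).points, x = p ∨ x = q := by
  classical
  have h : segmentMap γ (arc p q t) = FormalBary.mix
      (Set.projIcc 0 1 zero_le_one (min (4 * (t : ℝ) - 1) (4 - 4 * t)))
      (FormalBary.dirac (γ (Set.projIcc 0 1 zero_le_one (4 * t - 2))))
      (FormalBary.dirac (γ (Set.projIcc 0 1 zero_le_one (4 * t - 0)))) := rfl
  intro x
  rw [h]
  rcases le_total (t : ℝ) (1 / 4) with h1 | h1
  · rw [Set.projIcc_of_le_left _ (min_le_iff.2 (Or.inl (by linarith))),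
      Set.projIcc_of_le_left _ (by linarith : 4 * (t : ℝ) - 2 ≤ 0)]
    intro hx
    left
    simpa [show (⟨0, Set.left_mem_Icc.2 zero_le_one⟩ : unitInterval) = 0 from rfl] using hx
  rcases le_total (t : ℝ) (1 / 2) with h2 | h2
  · rw [Set.projIcc_of_le_left _ (by linarith : 4 * (t : ℝ) - 2 ≤ 0),
      Set.projIcc_of_right_le _ (by linarith : 1 ≤ 4 * (t : ℝ) - 0)]
    intro hx
    simpa [show (⟨0, Set.left_mem_Icc.2 zero_le_one⟩ : unitInterval) = 0 from rfl,
      show (⟨1, Set.right_mem_Icc.2 zero_le_one⟩ : unitInterval) = 1 from rfl] using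
        FormalBary.points_mix_subset _ _ _ hx
  rw [Set.projIcc_of_right_le _ (by linarith : 1 ≤ 4 * (t : ℝ) - 0)]
  intro hx
  right
  rcases le_total (t : ℝ) (3 / 4) with h3 | h3
  · rw [Set.projIcc_of_right_le _ (le_min (by linarith) (by linarith))] at hx
    simpa [show (⟨1, Set.right_mem_Icc.2 zero_le_one⟩ : unitInterval) = 1 from rfl] using hx
  · rw [Set.projIcc_of_right_le _ (by linarith : 1 ≤ 4 * (t : ℝ) - 2)] at hx
    simpa [show (⟨1, Set.right_mem_Icc.2 zero_le_one⟩ : unitInterval) = 1 from rfl] using hx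

/-- The map to `X` that sends the arc to `p` and identifies `q` with `p`. -/
def collapseArc (p q : X) : ArcAttach p q → X :=
  Quot.lift (Sum.elim (mergePoint p q) fun _ => p) (by rintro _ _ (_ | _) <;> simp)

@[simp] theorem collapseArc_inc (x : X) : collapseArc p q (inc p q x) = mergePoint p q x := rfl

@[simp] theorem collapseArc_arc (t : unitInterval) : collapseArc p q (arc p q t) = p := rfl

theorem mergePoint_of_mem_segmentMap (γ : Path p q) (z : ArcAttach p q) :
    ∀ x ∈ (segmentMap γ z).points, mergePoint p q x = collapseArc p q z := by
  revert z
  refine ind (fun y x hx => ?_) fun t x hx => ?_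
  · rw [segmentMap_inc, FormalBary.points_dirac, Finset.mem_singleton] at hx
    rw [hx]; rfl
  · rcases points_segmentMap_arc γ t x hx with rfl | rfl <;> simp

end ArcAttach

namespace PairCollapse

variable {X : Type*} [TopologicalSpace X] {p q : X}

theorem φ_right_neg (C : PairCollapse p q) (hpq : p ≠ q) : ¬ 0 ≤ C.φ q :=
  fun h => hpq ((C.H_one_of_φ q h).symm.trans (C.H_right 1))

open ArcAttach Classical in
/-- The collapse of a neighbourhood of `p`, followed by spreading this neighbourhood over the
initial piece of length `r` of the arc. For `r = 1` the points `p` and `q` have the same image. -/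
def spread (C : PairCollapse p q) (z : unitInterval × X) : ArcAttach p q :=
  if 0 ≤ C.φ z.2 then arc p q (z.1 * Set.projIcc 0 1 zero_le_one (C.φ z.2))
  else inc p q (C.H (1, z.2))

open ArcAttach

theorem continuous_spread (C : PairCollapse p q) : Continuous C.spread := by
  classical
  refine Continuous.if_le ?_ ?_ continuous_const (C.φ.continuous.comp continuous_snd) ?_
  · exact (arc p q).continuous.comp (continuous_fst.mul (continuous_projIcc.comp
      (C.φ.continuous.comp continuous_snd)))
  · exact (inc p q).continuous.comp (C.H.continuous.comp (continuous_const.prodMk continuous_snd))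
  · intro z hz
    rw [Set.projIcc_of_le_left _ hz.ge, C.H_one_of_φ _ hz.le]
    change arc p q (z.1 * 0) = _
    simp

theorem spread_left (C : PairCollapse p q) (r : unitInterval) : C.spread (r, p) = arc p q r := by
  simp [spread, C.φ_left]

theorem spread_right (C : PairCollapse p q) (hpq : p ≠ q) (r : unitInterval) :
    C.spread (r, q) = inc p q q := by
  simp [spread, C.φ_right_neg hpq, C.H_right]

theorem spread_zero (C : PairCollapse p q) (x : X) : C.spread (0, x) = inc p q (C.H (1, x)) := by
  unfold spread
  split_ifs with h
  · simp [C.H_one_of_φ x h]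
  · rfl

/-- The extension of `spread` to the arc, which is mapped onto its remaining piece. -/
def spreadArc (C : PairCollapse p q) (hpq : p ≠ q) (r : unitInterval) :
    C(ArcAttach p q, ArcAttach p q) :=
  lift ⟨fun x => C.spread (r, x), C.continuous_spread.comp (Continuous.prodMk_right r)⟩
    { toFun := fun s => arc p q (unitInterval.symm (unitInterval.symm r * unitInterval.symm s))
      continuous_toFun := (arc p q).continuous.comp (by fun_prop)
      source' := by simp [C.spread_left]
      target' := by simp [C.spread_right hpq] }

theorem spreadArc_one_homotopic (C : PairCollapse p q) (hpq : p ≠ q) :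
    (C.spreadArc hpq 1).Homotopic (ContinuousMap.id _) := by
  have h1 : (C.spreadArc hpq 0).Homotopic (C.spreadArc hpq 1) :=
    ⟨⟨⟨fun z => C.spreadArc hpq z.1 z.2, continuous_of_prod C.continuous_spread
      ((arc p q).continuous.comp (by fun_prop))⟩, fun _ => rfl, fun _ => rfl⟩⟩
  let F : unitInterval → C(ArcAttach p q, ArcAttach p q) := fun r =>
    lift ⟨fun x => inc p q (C.H (r, x)), (inc p q).continuous.comp (C.H.continuous.comp
      (Continuous.prodMk_right r))⟩ ((arc p q).cast (by simp [C.H_left]) (by simp [C.H_right]))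
  have h2 : (F 0).Homotopic (F 1) :=
    ⟨⟨⟨fun z => F z.1 z.2, continuous_of_prod ((inc p q).continuous.comp C.H.continuous)
      ((arc p q).continuous.comp continuous_snd)⟩, fun _ => rfl, fun _ => rfl⟩⟩
  have h3 : F 0 = ContinuousMap.id _ := by
    refine ContinuousMap.ext (ind (fun x => ?_) fun t => ?_)
    · exact congrArg (inc p q) (C.H_zero x)
    · rfl
  have h4 : F 1 = C.spreadArc hpq 0 := by
    refine ContinuousMap.ext (ind (fun x => ?_) fun t => ?_)
    · exact (C.spread_zero x).symm
    · simp [F, spreadArc]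
  rw [h4, h3] at h2
  exact (h2.trans h1).symm

theorem bind_H_mem_fiberBarySpace (C : PairCollapse p q) {n : ℕ} (t : unitInterval)
    {μ : FormalBary X} (hμ : μ ∈ fiberBarySpace (mergePoint p q) n) :
    (μ.bind fun x => FormalBary.dirac (C.H (t, x))) ∈ fiberBarySpace (mergePoint p q) n := by
  refine bind_mem_fiberBarySpace (fun x => mergePoint p q (C.H (t, x))) (fun x y hy => ?_) hμ
  rw [comp_mergePoint (f := fun x => mergePoint p q (C.H (t, x))) (by simp [C.H_left, C.H_right])]
  rw [FormalBary.points_dirac, Finset.mem_singleton] at hy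
  rw [hy]

/-- The map that merges the masses at `p` and `q`, induced by `spread`. -/
def mergeMap (C : PairCollapse p q) (hpq : p ≠ q) (n : ℕ) :
    C(fiberBarySpace (mergePoint p q) n, barySpace (ArcAttach p q) n) :=
  restrictSub (fun μ => μ.bind fun x => FormalBary.dirac (C.spread (1, x)))
    (continuous_map_dirac (C.continuous_spread.comp (Continuous.prodMk_right 1)))
    fun μ hμ => by
      rw [← fiberBarySpace_id]
      refine bind_mem_fiberBarySpace (fun x => C.spread (1, x)) (fun x y hy => ?_) hμ
      rw [comp_mergePoint (f := fun x => C.spread (1, x))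
        (by simp [C.spread_left, C.spread_right hpq])]
      simpa using hy

/-- The map that splits points of the arc into masses at `p` and `q`, induced by
`segmentMap`. -/
def splitMap (γ : Path p q) (n : ℕ) :
    C(barySpace (ArcAttach p q) n, fiberBarySpace (mergePoint p q) n) :=
  restrictSub (fun μ => μ.bind (segmentMap γ))
    ((FormalBary.continuous_bind (T := Unit) (K := fun _ => segmentMap γ)
      ((liftable_segmentMap γ).comp continuous_snd)).comp (Continuous.prodMk_right ()))
    fun μ hμ => by
      rw [← fiberBarySpace_id] at hμ
      exact bind_mem_fiberBarySpace (collapseArc p q) (mergePoint_of_mem_segmentMap γ) hμ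

/-- The map induced by the end `H (1, ·)` of the deformation. -/
def collapseMap (C : PairCollapse p q) (n : ℕ) :
    C(fiberBarySpace (mergePoint p q) n, fiberBarySpace (mergePoint p q) n) :=
  restrictSub (fun μ => μ.bind fun x => FormalBary.dirac (C.H (1, x)))
    (continuous_map_dirac (C.H.continuous.comp (Continuous.prodMk_right 1)))
    fun _ hμ => C.bind_H_mem_fiberBarySpace 1 hμ

theorem splitMap_comp_mergeMap_homotopic (C : PairCollapse p q) (hpq : p ≠ q) (γ : Path p q)
    (n : ℕ) : ((splitMap γ n).comp (C.mergeMap hpq n)).Homotopic (ContinuousMap.id _) := by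
  have h1 : (C.collapseMap n).Homotopic ((splitMap γ n).comp (C.mergeMap hpq n)) := by
    refine homotopic_of_global (fun z => z.2.bind fun x => segmentMap γ (C.spread (z.1, x)))
      (FormalBary.continuous_bind (K := fun t x => segmentMap γ (C.spread (t, x)))
        ((liftable_segmentMap γ).comp C.continuous_spread)) (fun t μ hμ => ?_) (fun μ => ?_)
        fun μ => ?_
    · refine bind_mem_fiberBarySpace (fun x => collapseArc p q (C.spread (t, x)))
        (fun x y hy => ?_) hμ
      rw [comp_mergePoint (f := fun x => collapseArc p q (C.spread (t, x)))
        (by simp [C.spread_left, C.spread_right hpq])]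
      exact mergePoint_of_mem_segmentMap γ _ y hy
    · change _ = μ.1.bind fun x => FormalBary.dirac (C.H (1, x))
      simp [C.spread_zero]
    · change _ = (μ.1.bind _).bind _
      simp [FormalBary.bind_bind]
  have h2 : (ContinuousMap.id _).Homotopic (C.collapseMap n) := by
    refine homotopic_of_global (fun z => z.2.bind fun x => FormalBary.dirac (C.H (z.1, x)))
      (continuous_bind_dirac C.H.continuous) (fun t μ hμ => C.bind_H_mem_fiberBarySpace t hμ)
      (fun μ => ?_) fun μ => rfl
    simp [C.H_zero]
  exact (h2.trans h1).symm

theorem mergeMap_comp_splitMap (C : PairCollapse p q) (hpq : p ≠ q) (γ : Path p q) (n : ℕ) :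
    (C.mergeMap hpq n).comp (splitMap γ n) = barySpaceMap (C.spreadArc hpq 1) n := by
  ext1 μ
  refine Subtype.ext ((FormalBary.bind_bind _ _ _).trans ?_)
  change μ.1.bind _ = μ.1.bind _
  congr 1
  funext z
  revert z
  refine ind (fun x => ?_) fun t => ?_
  · simp [spreadArc]
  · refine FormalBary.bind_eq_of_forall fun x hx => ?_
    have h : C.spreadArc hpq 1 (arc p q t) = inc p q q := by simp [spreadArc]
    rw [h]
    rcases points_segmentMap_arc γ t x hx with rfl | rfl
    · simp [C.spread_left]
    · simp [C.spread_right hpq]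

/-- Barycenters of at most `n` points of `X`, where `p` and `q` together count as one point, have
the homotopy type of barycenters of at most `n` points of the space obtained from `X` by
attaching an arc from `p` to `q`. -/
def fiberBarySpaceEquiv (C : PairCollapse p q) (hpq : p ≠ q) (γ : Path p q) (n : ℕ) :
    fiberBarySpace (mergePoint p q) n ≃ₕ barySpace (ArcAttach p q) n where
  toFun := C.mergeMap hpq n
  invFun := splitMap γ n
  left_inv := C.splitMap_comp_mergeMap_homotopic hpq γ n
  right_inv := by
    rw [mergeMap_comp_splitMap, ← barySpaceMap_id]
    exact barySpaceMap_homotopic (C.spreadArc_one_homotopic hpq) n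

end PairCollapse

/-! ### Counting points -/

section PairAdmissible

open Classical

variable {X : Type*} {p q : X} {n : ℕ} {S T : Finset X}

/-- The set `S` has at most `n` points other than `p` and `q`, and at most `n - 1` if it contains
both `p` and `q`. -/
def PairAdmissible (p q : X) (n : ℕ) (S : Finset X) : Prop :=
  (S \ {p, q}).card ≤ n ∧ (p ∈ S → q ∈ S → (S \ {p, q}).card + 1 ≤ n)

theorem PairAdmissible.mono (h : PairAdmissible p q n T) (hST : S ⊆ T) :
    PairAdmissible p q n S := by
  have := Finset.card_le_card (Finset.sdiff_subset_sdiff hST (subset_refl ({p, q} : Finset X)))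
  exact ⟨this.trans h.1, fun hp hq => (Nat.succ_le_succ this).trans (h.2 (hST hp) (hST hq))⟩

theorem image_mergePoint (p q : X) (S : Finset X) :
    S.image (mergePoint p q) = if p ∈ S ∨ q ∈ S then insert p (S \ {p, q}) else S \ {p, q} := by
  ext x
  split_ifs with h
  · simp only [Finset.mem_image, mergePoint, Finset.mem_insert, Finset.mem_sdiff,
      Finset.mem_singleton]
    constructor
    · rintro ⟨y, hy, rfl⟩
      split_ifs with hyq
      · exact Or.inl rfl
      · by_cases hyp : y = p
        · exact Or.inl hyp
        · exact Or.inr ⟨hy, by simp [hyp, hyq]⟩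
    · rintro (rfl | ⟨hx, h'⟩)
      · rcases h with h | h
        · exact ⟨x, h, by simp⟩
        · exact ⟨q, h, by simp⟩
      · push Not at h'
        exact ⟨x, hx, if_neg h'.2⟩
  · push Not at h
    simp only [Finset.mem_image, mergePoint, Finset.mem_insert, Finset.mem_sdiff,
      Finset.mem_singleton]
    constructor
    · rintro ⟨y, hy, rfl⟩
      have hyp : y ≠ p := fun h' => h.1 (h' ▸ hy)
      have hyq : y ≠ q := fun h' => h.2 (h' ▸ hy)
      simp [hyp, hyq, hy]
    · rintro ⟨hx, h'⟩
      push Not at h'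
      exact ⟨x, hx, if_neg h'.2⟩

theorem card_image_mergePoint_le_iff :
    (S.image (mergePoint p q)).card ≤ n ↔
      (S \ {p, q}).card ≤ n ∧ (p ∈ S ∨ q ∈ S → (S \ {p, q}).card + 1 ≤ n) := by
  rw [image_mergePoint]
  split_ifs with h
  · rw [Finset.card_insert_of_notMem (by simp)]
    exact ⟨fun h' => ⟨by omega, fun _ => h'⟩, fun h' => h'.2 h⟩
  · exact ⟨fun h' => ⟨h', fun h'' => absurd h'' h⟩, fun h' => h'.1⟩

theorem PairAdmissible.image (h : PairAdmissible p q n S) {f : X → X} (hp : f p = p)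
    (hq : f q = q) : PairAdmissible p q n (S.image f) := by
  have h1 : S.image f \ {p, q} ⊆ (S \ {p, q}).image f := by
    intro x hx
    simp only [Finset.mem_sdiff, Finset.mem_image, Finset.mem_insert, Finset.mem_singleton] at hx ⊢
    obtain ⟨⟨y, hy, rfl⟩, h2⟩ := hx
    refine ⟨y, ⟨hy, ?_⟩, rfl⟩
    rintro (rfl | rfl)
    exacts [h2 (Or.inl hp), h2 (Or.inr hq)]
  have h2 := (Finset.card_le_card h1).trans Finset.card_image_le
  refine ⟨h2.trans h.1, fun hp' hq' => ?_⟩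
  by_cases hpq : p ∈ S ∧ q ∈ S
  · exact (Nat.succ_le_succ h2).trans (h.2 hpq.1 hpq.2)
  -- One of `p`, `q` is not in `S`; then it is the image of one of the other points of `S`.
  · obtain ⟨z, hz, hzS, hzp⟩ : ∃ z ∈ S.image f, z ∉ S ∧ (z = p ∨ z = q) := by
      rw [not_and_or] at hpq
      rcases hpq with h | h
      exacts [⟨p, hp', h, Or.inl rfl⟩, ⟨q, hq', h, Or.inr rfl⟩]
    obtain ⟨y, hy, rfl⟩ := Finset.mem_image.1 hz
    have hyP : y ∈ S \ {p, q} := by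
      simp only [Finset.mem_sdiff, Finset.mem_insert, Finset.mem_singleton]
      refine ⟨hy, ?_⟩
      rintro (rfl | rfl)
      exacts [hzS (hp.symm ▸ hy), hzS (hq.symm ▸ hy)]
    have h3 : S.image f \ {p, q} ⊆ ((S \ {p, q}).erase y).image f := by
      intro x hx
      obtain ⟨w, hw, rfl⟩ := Finset.mem_image.1 (h1 hx)
      refine Finset.mem_image_of_mem _ (Finset.mem_erase.2 ⟨?_, hw⟩)
      rintro rfl
      exact (Finset.mem_sdiff.1 hx).2 (by simpa using hzp)
    have h4 := (Finset.card_le_card h3).trans Finset.card_image_le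
    rw [Finset.card_erase_of_mem hyP] at h4
    have h5 := Finset.card_pos.2 ⟨y, hyP⟩
    have := h.1
    omega

theorem card_image_mergePoint_image_le (h : (S.image (mergePoint p q)).card ≤ n) {f : X → X}
    (hp : f p = p) (hq : f q = q) : ((S.image f).image (mergePoint p q)).card ≤ n := by
  refine le_trans ?_ (Finset.card_image_le.trans h :
    ((S.image (mergePoint p q)).image (mergePoint p q ∘ f)).card ≤ n)
  refine Finset.card_le_card fun b hb => ?_
  simp only [Finset.mem_image, exists_exists_and_eq_and, Function.comp] at hb ⊢
  obtain ⟨x, hx, rfl⟩ := hb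
  exact ⟨x, hx, comp_mergePoint (f := fun x => mergePoint p q (f x)) (by simp [hp, hq]) x⟩

theorem sdiff_pair_subset_of_subset_insert {x : X} (hx : x = p ∨ x = q) (h : T ⊆ insert x S) :
    T \ {p, q} ⊆ S \ {p, q} := by
  intro y hy
  simp only [Finset.mem_sdiff, Finset.mem_insert, Finset.mem_singleton] at hy ⊢
  rcases Finset.mem_insert.1 (h hy.1) with rfl | h'
  exacts [absurd hx hy.2, ⟨h', hy.2⟩]

theorem pairAdmissible_of_subset_insert (h : (S.image (mergePoint p q)).card ≤ n) (hpq : p ≠ q)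
    {x : X} (hx : x = p ∨ x = q) (hT : T ⊆ insert x S) : PairAdmissible p q n T := by
  rw [card_image_mergePoint_le_iff] at h
  have h1 := Finset.card_le_card (sdiff_pair_subset_of_subset_insert hx hT)
  refine ⟨h1.trans h.1, fun hp hq => (Nat.succ_le_succ h1).trans (h.2 ?_)⟩
  rcases hx with rfl | rfl
  · exact Or.inr ((Finset.mem_insert.1 (hT hq)).resolve_left hpq.symm)
  · exact Or.inl ((Finset.mem_insert.1 (hT hp)).resolve_left hpq)

theorem card_image_mergePoint_le_of_subset (h : (S.image (mergePoint p q)).card ≤ n)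
    (hS : p ∈ S ∨ q ∈ S) (hT : T ⊆ insert p (insert q S)) :
    (T.image (mergePoint p q)).card ≤ n := by
  rw [card_image_mergePoint_le_iff] at h ⊢
  have h1 : T \ {p, q} ⊆ S \ {p, q} := by
    intro y hy
    have := hT (Finset.mem_sdiff.1 hy).1
    simp only [Finset.mem_sdiff, Finset.mem_insert, Finset.mem_singleton] at hy this ⊢
    tauto
  have h2 := Finset.card_le_card h1
  exact ⟨h2.trans h.1, fun _ => (Nat.succ_le_succ h2).trans (h.2 hS)⟩

end PairAdmissible

/-- The barycenters with at most `n` points besides `p` and `q`, and at most `n - 1` if both `p`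
and `q` occur. -/
def pairBarySpace {X : Type*} (p q : X) (n : ℕ) : Set (FormalBary X) :=
  {μ | PairAdmissible p q n μ.points}

/-! ### Maps into suspensions -/

namespace Suspension

variable {A Z : Type*} [TopologicalSpace A] [TopologicalSpace Z] {D : Set A}

open Classical in
/-- The point of the suspension over `a` at height `k`, where heights `k ≤ 0` and `1 ≤ k` stand for
the poles. For `0 < k < 1` this is meaningful if `a ∈ D`. -/
def clamp (D : Set A) (a : A) (k : ℝ) : Suspension D :=
  if h : a ∈ D ∧ k ∈ Set.Icc (0 : ℝ) 1 then point ⟨a, h.1⟩ ⟨k, h.2⟩ else pole D (decide (1 / 2 ≤ k))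

omit [TopologicalSpace A] in
theorem clamp_of_mem {a : A} (ha : a ∈ D) {k : ℝ} (hk : k ∈ Set.Icc (0 : ℝ) 1) :
    clamp D a k = point ⟨a, ha⟩ ⟨k, hk⟩ := dif_pos ⟨ha, hk⟩

omit [TopologicalSpace A] in
theorem clamp_of_nonpos (a : A) {k : ℝ} (hk : k ≤ 0) : clamp D a k = pole D false := by
  unfold clamp
  split_ifs with h
  · have : (⟨k, h.2⟩ : unitInterval) = 0 := Subtype.ext (le_antisymm hk h.2.1)
    rw [this, point_zero]
  · rw [decide_eq_false (by linarith)]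

omit [TopologicalSpace A] in
theorem clamp_of_one_le (a : A) {k : ℝ} (hk : 1 ≤ k) : clamp D a k = pole D true := by
  unfold clamp
  split_ifs with h
  · have : (⟨k, h.2⟩ : unitInterval) = 1 := Subtype.ext (le_antisymm h.2.2 hk)
    rw [this, point_one]
  · rw [decide_eq_true (by linarith)]

theorem continuous_clamp {F : Z → A} {k : Z → ℝ} (hF : Continuous F) (hk : Continuous k)
    (hD : ∀ z, 0 ≤ k z → k z ≤ 1 → F z ∈ D) : Continuous fun z => clamp D (F z) (k z) := by
  rw [← continuousOn_univ]
  have hcover : (Set.univ : Set Z) = (k ⁻¹' Set.Icc 0 1 ∪ k ⁻¹' Set.Iic 0) ∪ k ⁻¹' Set.Ici 1 := by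
    ext z
    simp only [Set.mem_univ, Set.mem_union, Set.mem_preimage, Set.mem_Icc, Set.mem_Iic,
      Set.mem_Ici, true_iff]
    rcases le_total (k z) 0 with h | h
    · exact Or.inl (Or.inr h)
    rcases le_total (k z) 1 with h' | h'
    exacts [Or.inl (Or.inl ⟨h, h'⟩), Or.inr h']
  rw [hcover]
  refine ContinuousOn.union_of_isClosed (ContinuousOn.union_of_isClosed ?_ ?_
    (isClosed_Icc.preimage hk) (isClosed_Iic.preimage hk)) ?_
    ((isClosed_Icc.preimage hk).union (isClosed_Iic.preimage hk)) (isClosed_Ici.preimage hk)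
  · rw [continuousOn_iff_continuous_domRestrict]
    have : (k ⁻¹' Set.Icc 0 1).domRestrict (fun z => clamp D (F z) (k z)) =
        fun z : (k ⁻¹' Set.Icc 0 1 : Set Z) => point ⟨F z, hD z z.2.1 z.2.2⟩ ⟨k z, z.2⟩ :=
      funext fun z => clamp_of_mem _ z.2
    rw [this]
    exact continuous_point.comp
      (((hF.comp continuous_subtype_val).subtype_mk _).prodMk
        ((hk.comp continuous_subtype_val).subtype_mk _))
  · exact continuousOn_const.congr fun z hz => clamp_of_nonpos _ hz
  · exact continuousOn_const.congr fun z hz => clamp_of_one_le _ hz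

/-- A homotopy of self-maps of a suspension given by a homotopy on the cylinder that is constant on
the ends. -/
theorem homotopic_of_clamp {f g : C(Suspension D, Suspension D)}
    {F : unitInterval × (D × unitInterval) → A} {k : unitInterval × (D × unitInterval) → ℝ}
    (hF : Continuous F) (hk : Continuous k) (hD : ∀ z, 0 ≤ k z → k z ≤ 1 → F z ∈ D)
    (hk0 : ∀ r d, k (r, (d, 0)) ≤ 0) (hk1 : ∀ r d, 1 ≤ k (r, (d, 1)))
    (hf : ∀ d s, f (point d s) = clamp D (F (0, (d, s))) (k (0, (d, s))))
    (hg : ∀ d s, g (point d s) = clamp D (F (1, (d, s))) (k (1, (d, s))))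
    (hfp : ∀ b, f (pole D b) = pole D b) (hgp : ∀ b, g (pole D b) = pole D b) :
    f.Homotopic g := by
  refine ⟨⟨⟨fun z => lift (fun w => clamp D (F (z.1, w)) (k (z.1, w))) (pole D)
    (fun d => clamp_of_nonpos _ (hk0 _ d)) (fun d => clamp_of_one_le _ (hk1 _ d)) z.2,
    continuous_of_point (continuous_clamp hF hk hD) fun b => continuous_const⟩, ?_, ?_⟩⟩
  · rintro ⟨⟨d, s⟩ | b⟩
    exacts [(hf d s).symm, (hfp b).symm]
  · rintro ⟨⟨d, s⟩ | b⟩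
    exacts [(hg d s).symm, (hgp b).symm]

end Suspension

/-! ### The two cones over the barycenters that count `p` and `q` as one point -/

namespace FormalBary

variable {X Z : Type*} {p q : X}

/-- For `s ≤ 1 / 2` the line segments from `p` at `s = 0` to `μ` at `s = 1 / 2`, and
for `1 / 2 ≤ s` the line segments from `μ` to `q`. -/
def join (p q : X) (s : unitInterval) (μ : FormalBary X) : FormalBary X :=
  mix (Set.projIcc 0 1 zero_le_one (2 * s - 1))
    (mix (Set.projIcc 0 1 zero_le_one (1 - 2 * s)) μ (dirac p)) (dirac q)

@[simp] theorem join_zero (μ : FormalBary X) : join p q 0 μ = dirac p := by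
  have h1 : Set.projIcc (0 : ℝ) 1 zero_le_one (2 * (0 : unitInterval) - 1) = 0 :=
    Set.projIcc_of_le_left _ (by simp)
  have h2 : Set.projIcc (0 : ℝ) 1 zero_le_one (1 - 2 * (0 : unitInterval)) = 1 :=
    Set.projIcc_of_right_le _ (by simp)
  rw [join, h1, h2, mix_zero, mix_one]

@[simp] theorem join_one (μ : FormalBary X) : join p q 1 μ = dirac q := by
  have h1 : Set.projIcc (0 : ℝ) 1 zero_le_one (2 * (1 : unitInterval) - 1) = 1 :=
    Set.projIcc_of_right_le _ (by norm_num)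
  rw [join, h1, mix_one]

theorem mem_points_join {s : unitInterval} {μ : FormalBary X} {x : X}
    (hx : x ∈ (join p q s μ).points) :
    x ∈ μ.points ∨ (x = p ∧ (s : ℝ) < 1 / 2) ∨ (x = q ∧ 1 / 2 < (s : ℝ)) := by
  classical
  unfold join at hx
  rcases le_or_gt (s : ℝ) (1 / 2) with h | h
  · have h1 : Set.projIcc (0 : ℝ) 1 zero_le_one (2 * s - 1) = 0 :=
      Set.projIcc_of_le_left _ (by linarith)
    rw [h1, mix_zero] at hx
    rcases h.lt_or_eq with h' | h'
    · rcases Finset.mem_union.1 (points_mix_subset _ _ _ hx) with h3 | h3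
      · exact Or.inl h3
      · exact Or.inr (Or.inl ⟨by simpa using h3, h'⟩)
    · have h2 : Set.projIcc (0 : ℝ) 1 zero_le_one (1 - 2 * s) = 0 :=
        Set.projIcc_of_le_left _ (by linarith)
      rw [h2, mix_zero] at hx
      exact Or.inl hx
  · have h2 : Set.projIcc (0 : ℝ) 1 zero_le_one (1 - 2 * s) = 0 :=
      Set.projIcc_of_le_left _ (by linarith)
    rw [h2, mix_zero] at hx
    rcases Finset.mem_union.1 (points_mix_subset _ _ _ hx) with h3 | h3
    · exact Or.inl h3
    · exact Or.inr (Or.inr ⟨by simpa using h3, h⟩)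

theorem Liftable.join [TopologicalSpace X] [TopologicalSpace Z] {F : Z → FormalBary X}
    (hF : Liftable F) {s : Z → unitInterval} (hs : Continuous s) :
    Liftable fun z => join p q (s z) (F z) := by
  have hs' : Continuous fun z => (s z : ℝ) := continuous_subtype_val.comp hs
  exact (hF.mix (liftable_dirac continuous_const)
    (continuous_projIcc.comp (continuous_const.sub (continuous_const.mul hs')))).mix
    (liftable_dirac continuous_const)
    (continuous_projIcc.comp ((continuous_const.mul hs').sub continuous_const))

end FormalBary

namespace PairCollapse

open FormalBary

variable {X Z : Type*} [TopologicalSpace X] [TopologicalSpace Z] {p q : X} (C : PairCollapse p q)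

/-- The mass of `μ` near `p`. -/
def massLeft (μ : FormalBary X) : ℝ := μ.integral fun x => max (C.φ x) 0

/-- The mass of `μ` near `q`. -/
def massRight (μ : FormalBary X) : ℝ := μ.integral fun x => max (C.ψ x) 0

theorem massLeft_nonneg (μ : FormalBary X) : 0 ≤ C.massLeft μ :=
  μ.integral_nonneg fun _ => le_max_right _ _

theorem massRight_nonneg (μ : FormalBary X) : 0 ≤ C.massRight μ :=
  μ.integral_nonneg fun _ => le_max_right _ _

/-- The density that is removed near `p` and `q`. -/
def bump (x : X) : ℝ := max (C.φ x) 0 + max (C.ψ x) 0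

theorem continuous_bump : Continuous C.bump := by unfold bump; fun_prop

theorem bump_nonneg (x : X) : 0 ≤ C.bump x := add_nonneg (le_max_right _ _) (le_max_right _ _)

theorem ψ_left_neg (hpq : p ≠ q) : C.ψ p < 0 :=
  not_le.1 fun h => hpq ((C.H_left 1).symm.trans (C.H_one_of_ψ p h))

theorem bump_le_one (hpq : p ≠ q) (x : X) : C.bump x ≤ 1 := by
  unfold bump
  rcases le_or_gt 0 (C.φ x) with h | h
  · have h' : C.ψ x < 0 :=
      not_le.1 fun h' => hpq ((C.H_one_of_φ x h).symm.trans (C.H_one_of_ψ x h'))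
    rw [max_eq_right h'.le, add_zero]
    exact max_le (C.φ_le_one x) zero_le_one
  · rw [max_eq_right h.le, zero_add]
    exact max_le (C.ψ_le_one x) zero_le_one

theorem bump_left (hpq : p ≠ q) : C.bump p = 1 := by
  simp [bump, C.φ_left, (C.ψ_left_neg hpq).le]

theorem bump_right (hpq : p ≠ q) : C.bump q = 1 := by
  simp [bump, C.ψ_right, (not_le.1 (C.φ_right_neg hpq)).le]

theorem integral_bump (μ : FormalBary X) : μ.integral C.bump = C.massLeft μ + C.massRight μ :=
  μ.integral_add _ _

theorem massLeft_add_massRight_le (hpq : p ≠ q) (μ : FormalBary X) :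
    C.massLeft μ + C.massRight μ ≤ 1 := by
  rw [← C.integral_bump, ← μ.integral_one]
  exact μ.integral_mono (C.bump_le_one hpq)

/-- The fraction of the mass near `p` and `q` that is removed. All of it is removed if there is no
mass near one of the two points and not more than half of the total mass near the other. -/
def fraction (μ : FormalBary X) : ℝ :=
  (1 - min (C.massLeft μ) (C.massRight μ)) *
    min 1 (2 * (1 - |C.massLeft μ - C.massRight μ|))

theorem fraction_mem (hpq : p ≠ q) (μ : FormalBary X) : C.fraction μ ∈ Set.Icc (0 : ℝ) 1 := by
  have h1 := C.massLeft_nonneg μ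
  have h2 := C.massRight_nonneg μ
  have h3 := C.massLeft_add_massRight_le hpq μ
  have h4 : |C.massLeft μ - C.massRight μ| ≤ 1 := abs_le.2 ⟨by linarith, by linarith⟩
  have h5 : 0 ≤ min (C.massLeft μ) (C.massRight μ) := le_min h1 h2
  have h6 : min (C.massLeft μ) (C.massRight μ) ≤ 1 := min_le_iff.2 (Or.inl (by linarith))
  have h7 : 0 ≤ min 1 (2 * (1 - |C.massLeft μ - C.massRight μ|)) :=
    le_min zero_le_one (by linarith)
  exact ⟨mul_nonneg (by linarith) h7, mul_le_one₀ (by linarith) h7 (min_le_left _ _)⟩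

theorem fraction_mul_lt_one (hpq : p ≠ q) (μ : FormalBary X) :
    C.fraction μ * (C.massLeft μ + C.massRight μ) < 1 := by
  have h1 := C.massLeft_nonneg μ
  have h2 := C.massRight_nonneg μ
  have h3 := C.massLeft_add_massRight_le hpq μ
  have h4 := C.fraction_mem hpq μ
  by_contra! h
  have h5 : C.massLeft μ + C.massRight μ = 1 := le_antisymm h3
    (h.trans (mul_le_of_le_one_left (by linarith) h4.2))
  rw [h5, mul_one] at h
  unfold fraction at h
  have h8 : min 1 (2 * (1 - |C.massLeft μ - C.massRight μ|)) ≤ 1 := min_le_left _ _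
  have h9 : min 1 (2 * (1 - |C.massLeft μ - C.massRight μ|)) ≤
    2 * (1 - |C.massLeft μ - C.massRight μ|) := min_le_right _ _
  have h6 : 0 ≤ min (C.massLeft μ) (C.massRight μ) := le_min h1 h2
  have h7 : min (C.massLeft μ) (C.massRight μ) ≤ 1 := min_le_iff.2 (Or.inl (by linarith))
  have h10 : min (C.massLeft μ) (C.massRight μ) = 0 := by nlinarith
  rw [h10, sub_zero, one_mul] at h
  rcases min_eq_iff.1 h10 with h11 | h11
  · have : |C.massLeft μ - C.massRight μ| = C.massRight μ := by
      rw [h11.1, zero_sub, abs_neg, abs_of_nonneg h2]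
    linarith
  · have : |C.massLeft μ - C.massRight μ| = C.massLeft μ := by
      rw [h11.1, sub_zero, abs_of_nonneg h1]
    linarith

theorem fraction_eq_one {μ : FormalBary X} (h0 : C.massLeft μ = 0 ∨ C.massRight μ = 0)
    (h : |C.massLeft μ - C.massRight μ| ≤ 1 / 2) : C.fraction μ = 1 := by
  have h1 : min (C.massLeft μ) (C.massRight μ) = 0 := by
    rcases h0 with h0 | h0
    · rw [h0, min_eq_left (C.massRight_nonneg μ)]
    · rw [h0, min_eq_right (C.massLeft_nonneg μ)]
  rw [fraction, h1, min_eq_left (by linarith)]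
  norm_num

/-- The barycenter obtained by removing a fraction of the mass near `p` and `q`, normalizing, and
applying the collapsing map. -/
def peel (hpq : p ≠ q) (μ : FormalBary X) : FormalBary X :=
  (μ.reweight (fun x => 1 - C.fraction μ * C.bump x)
    (fun x => sub_nonneg.2 (mul_le_one₀ (C.fraction_mem hpq μ).2 (C.bump_nonneg x)
      (C.bump_le_one hpq x)))
    (by
      rw [integral_one_sub_mul, integral_bump]
      exact sub_pos.2 (C.fraction_mul_lt_one hpq μ))).bind fun x => dirac (C.H (1, x))

/-- The height of the image of `μ` in the suspension; values outside `[0, 1]` stand for the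
poles. -/
def height (μ : FormalBary X) : ℝ := 1 / 2 + C.massRight μ - C.massLeft μ

theorem abs_sub_le_of_height {μ : FormalBary X} (h0 : 0 ≤ C.height μ) (h1 : C.height μ ≤ 1) :
    |C.massLeft μ - C.massRight μ| ≤ 1 / 2 := by
  unfold height at h0 h1
  exact abs_le.2 ⟨by linarith, by linarith⟩

theorem mem_points_peel (hpq : p ≠ q) {μ : FormalBary X} {x : X}
    (hx : x ∈ (C.peel hpq μ).points) :
    ∃ y ∈ μ.points, C.H (1, y) = x ∧ (C.fraction μ = 1 → y ≠ p ∧ y ≠ q) := by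
  classical
  obtain ⟨y, hy, hxy⟩ := Finset.mem_biUnion.1 (points_bind_subset _ _ hx)
  rw [points_dirac, Finset.mem_singleton] at hxy
  obtain ⟨h1, h2⟩ := points_reweight_subset _ _ _ _ hy
  refine ⟨y, h1, hxy.symm, fun h => ⟨?_, ?_⟩⟩
  · rintro rfl
    rw [h, C.bump_left hpq] at h2
    norm_num at h2
  · rintro rfl
    rw [h, C.bump_right hpq] at h2
    norm_num at h2

theorem mem_image_of_massLeft_pos {μ : FormalBary X} (h : C.massLeft μ ≠ 0) :
    ∃ x ∈ μ.points, C.H (1, x) = p := by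
  by_contra! h'
  refine h ((μ.integral_eq_zero_iff fun _ => le_max_right _ _).2 fun x hx => max_eq_right ?_)
  exact (not_le.1 fun h'' => h' x hx (C.H_one_of_φ x h'')).le

theorem mem_image_of_massRight_pos {μ : FormalBary X} (h : C.massRight μ ≠ 0) :
    ∃ x ∈ μ.points, C.H (1, x) = q := by
  by_contra! h'
  refine h ((μ.integral_eq_zero_iff fun _ => le_max_right _ _).2 fun x hx => max_eq_right ?_)
  exact (not_le.1 fun h'' => h' x hx (C.H_one_of_ψ x h'')).le

/-! ### Continuity of the peeling map -/

section Liftable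

variable {C} {F : Z → FormalBary X}

theorem _root_.FormalBary.Liftable.continuous_massLeft (hF : Liftable F) :
    Continuous fun z => C.massLeft (F z) :=
  hF.integral_continuous (g := fun _ x => max (C.φ x) 0) (by fun_prop)

theorem _root_.FormalBary.Liftable.continuous_massRight (hF : Liftable F) :
    Continuous fun z => C.massRight (F z) :=
  hF.integral_continuous (g := fun _ x => max (C.ψ x) 0) (by fun_prop)

theorem _root_.FormalBary.Liftable.map {Y : Type*} [TopologicalSpace Y] (hF : Liftable F)
    {f : Z × X → Y} (hf : Continuous f) :
    Liftable fun z => (F z).bind fun x => dirac (f (z, x)) :=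
  hF.bind (K := fun z x => dirac (f (z, x))) (liftable_dirac hf)

theorem _root_.FormalBary.Liftable.peel (hF : Liftable F) (hpq : p ≠ q) :
    Liftable fun z => C.peel hpq (F z) := by
  refine Liftable.map (hF.reweight (g := fun z x => 1 - C.fraction (F z) * C.bump x) ?_ _ _)
    (f := fun w => C.H (1, w.2)) (C.H.continuous.comp (continuous_const.prodMk continuous_snd))
  have h1 := hF.continuous_massLeft (C := C)
  have h2 := hF.continuous_massRight (C := C)
  have h3 : Continuous fun z => C.fraction (F z) := by unfold fraction; fun_prop
  exact continuous_const.sub ((h3.comp continuous_fst).mul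
    (C.continuous_bump.comp continuous_snd))

end Liftable

theorem continuous_height : Continuous C.height :=
  (continuous_const.add (continuous_integral (by fun_prop))).sub
    (continuous_integral (by fun_prop))

theorem continuous_peel (hpq : p ≠ q) : Continuous (C.peel hpq) :=
  continuous_of_mk_right fun k => ((liftable_mk k).peel hpq).continuous

theorem continuous_join : Continuous fun z : unitInterval × FormalBary X => join p q z.1 z.2 :=
  continuous_of_mk fun k =>
    (((liftable_mk k).comp continuous_snd).join continuous_fst).continuous

/-! ### The suspension decomposition -/

omit [TopologicalSpace X] in
open Classical in
theorem mem_fiberBarySpace_of_points {n : ℕ} {μ : FormalBary X} {S : Finset X}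
    (h : μ.points ⊆ S) (hS : (S.image (mergePoint p q)).card ≤ n) :
    μ ∈ fiberBarySpace (mergePoint p q) n :=
  (Finset.card_le_card (Finset.image_subset_image h)).trans hS

theorem peel_mem (hpq : p ≠ q) {n : ℕ} {μ : FormalBary X} (hμ : μ ∈ pairBarySpace p q n)
    (h0 : 0 ≤ C.height μ) (h1 : C.height μ ≤ 1) :
    C.peel hpq μ ∈ fiberBarySpace (mergePoint p q) n := by
  classical
  by_cases h : C.massLeft μ = 0 ∨ C.massRight μ = 0
  · have h2 := C.fraction_eq_one h (C.abs_sub_le_of_height h0 h1)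
    refine mem_fiberBarySpace_of_points (S := (μ.points \ {p, q}).image fun x => C.H (1, x))
      (fun x hx => ?_) (card_image_mergePoint_image_le ?_ (C.H_left 1) (C.H_right 1))
    · obtain ⟨y, hy, hyx, hf⟩ := C.mem_points_peel hpq hx
      exact Finset.mem_image.2 ⟨y, by simp [hy, hf h2], hyx⟩
    · rw [card_image_mergePoint_le_iff]
      refine ⟨(Finset.card_le_card Finset.sdiff_subset).trans ?_, by simp⟩
      convert hμ.1
  · push Not at h
    have hS : PairAdmissible p q n (μ.points.image fun x => C.H (1, x)) :=
      PairAdmissible.image hμ (C.H_left 1) (C.H_right 1)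
    refine mem_fiberBarySpace_of_points (S := μ.points.image fun x => C.H (1, x))
      (fun x hx => ?_) (card_image_mergePoint_le_iff.2 ?_)
    · obtain ⟨y, hy, hyx, -⟩ := C.mem_points_peel hpq hx
      exact Finset.mem_image.2 ⟨y, hy, hyx⟩
    · have := hS.2 (Finset.mem_image.2 (C.mem_image_of_massLeft_pos h.1))
        (Finset.mem_image.2 (C.mem_image_of_massRight_pos h.2))
      refine ⟨?_, fun _ => ?_⟩
      · convert hS.1
      · convert this

omit [TopologicalSpace X] in
theorem join_mem (hpq : p ≠ q) {n : ℕ} {μ : FormalBary X}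
    (hμ : μ ∈ fiberBarySpace (mergePoint p q) n) (s : unitInterval) :
    join p q s μ ∈ pairBarySpace p q n := by
  classical
  rcases le_or_gt (s : ℝ) (1 / 2) with h | h
  · refine pairAdmissible_of_subset_insert (S := μ.points) hμ hpq (Or.inl rfl) fun x hx => ?_
    rcases mem_points_join hx with h' | h' | h'
    · exact Finset.mem_insert_of_mem h'
    · rw [h'.1]; exact Finset.mem_insert_self _ _
    · exact absurd h'.2 (not_lt.2 h)
  · refine pairAdmissible_of_subset_insert (S := μ.points) hμ hpq (Or.inr rfl) fun x hx => ?_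
    rcases mem_points_join hx with h' | h' | h'
    · exact Finset.mem_insert_of_mem h'
    · exact absurd h'.2 (not_lt.2 h.le)
    · rw [h'.1]; exact Finset.mem_insert_self _ _

omit [TopologicalSpace X] in
theorem dirac_mem_pairBarySpace (hpq : p ≠ q) (n : ℕ) (b : Bool) :
    dirac (cond b q p) ∈ pairBarySpace p q n := by
  classical
  have h : ∀ x, x = p ∨ x = q → ({x} : Finset X) \ {p, q} = ∅ := fun x hx => by
    simpa [Finset.sdiff_eq_empty_iff_subset] using hx
  cases b <;> simp [pairBarySpace, PairAdmissible, hpq, hpq.symm, h]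

/-- The map from `pairBarySpace p q n` to the suspension. -/
def toSuspension (hpq : p ≠ q) (n : ℕ) :
    C(pairBarySpace p q n, Suspension (fiberBarySpace (mergePoint p q) n)) :=
  ⟨fun μ => Suspension.clamp _ (C.peel hpq μ) (C.height μ),
    Suspension.continuous_clamp ((C.continuous_peel hpq).comp continuous_subtype_val)
      (C.continuous_height.comp continuous_subtype_val) fun μ => C.peel_mem hpq μ.2⟩

/-- The map from the suspension given by the line segments to `p` and `q`. -/
def ofSuspension (hpq : p ≠ q) (n : ℕ) :
    C(Suspension (fiberBarySpace (mergePoint p q) n), pairBarySpace p q n) :=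
  ⟨Suspension.lift (fun z => ⟨join p q z.2 z.1, join_mem hpq z.1.2 z.2⟩)
    (fun b => ⟨dirac (cond b q p), dirac_mem_pairBarySpace hpq n b⟩)
    (fun _ => Subtype.ext (join_zero _)) (fun _ => Subtype.ext (join_one _)),
    Suspension.continuous_lift ((continuous_join.comp (continuous_snd.prodMk
      (continuous_subtype_val.comp continuous_fst))).subtype_mk _) _ _⟩

@[simp] theorem massLeft_dirac_left : C.massLeft (dirac p) = 1 := by
  simp [massLeft, C.φ_left]

theorem massRight_dirac_left (hpq : p ≠ q) : C.massRight (dirac p) = 0 := by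
  simp [massRight, (C.ψ_left_neg hpq).le]

theorem massLeft_dirac_right (hpq : p ≠ q) : C.massLeft (dirac q) = 0 := by
  simp [massLeft, (not_le.1 (C.φ_right_neg hpq)).le]

@[simp] theorem massRight_dirac_right : C.massRight (dirac q) = 1 := by
  simp [massRight, C.ψ_right]

theorem height_dirac_left (hpq : p ≠ q) : C.height (dirac p) = -(1 / 2) := by
  rw [height, C.massLeft_dirac_left, C.massRight_dirac_left hpq]; norm_num

theorem height_dirac_right (hpq : p ≠ q) : C.height (dirac q) = 3 / 2 := by
  rw [height, C.massRight_dirac_right, C.massLeft_dirac_right hpq]; norm_num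

theorem coe_ofSuspension_clamp (hpq : p ≠ q) (n : ℕ) {μ : FormalBary X} {k : ℝ}
    (h : 0 ≤ k → k ≤ 1 → μ ∈ fiberBarySpace (mergePoint p q) n) :
    (ofSuspension hpq n (Suspension.clamp _ μ k) : FormalBary X) =
      join p q (Set.projIcc 0 1 zero_le_one k) μ := by
  rcases le_total k 0 with h0 | h0
  · rw [Suspension.clamp_of_nonpos _ h0, Set.projIcc_of_le_left _ h0]
    exact (join_zero μ).symm
  rcases le_total 1 k with h1 | h1
  · rw [Suspension.clamp_of_one_le _ h1, Set.projIcc_of_right_le _ h1]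
    exact (join_one μ).symm
  · rw [Suspension.clamp_of_mem (h h0 h1) ⟨h0, h1⟩, Set.projIcc_of_mem _ ⟨h0, h1⟩]
    rfl

/-- After the deformation to the collapsing map, all barycenters on the line segment from `μ` to
its image are supported on the points of `μ`. -/
theorem ofSuspension_comp_toSuspension_homotopic (hpq : p ≠ q) (n : ℕ) :
    ((ofSuspension hpq n).comp (C.toSuspension hpq n)).Homotopic (ContinuousMap.id _) := by
  classical
  have hH : ∀ t, ∀ μ ∈ pairBarySpace p q n,
      PairAdmissible p q n (μ.points.image fun x => C.H (t, x)) := fun t μ hμ =>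
    PairAdmissible.image hμ (C.H_left t) (C.H_right t)
  have hHs : ∀ t, ∀ μ : FormalBary X, (μ.bind fun x => dirac (C.H (t, x))).points ⊆
      μ.points.image fun x => C.H (t, x) := fun t μ x hx => by
    obtain ⟨y, hy, hxy⟩ := Finset.mem_biUnion.1 (points_bind_subset _ _ hx)
    rw [points_dirac, Finset.mem_singleton] at hxy
    exact Finset.mem_image.2 ⟨y, hy, hxy.symm⟩
  let f : C(pairBarySpace p q n, pairBarySpace p q n) :=
    restrictSub (fun μ => μ.bind fun x => dirac (C.H (1, x)))
      (continuous_map_dirac (C.H.continuous.comp (Continuous.prodMk_right 1)))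
      fun μ hμ => (hH 1 μ hμ).mono (hHs 1 μ)
  have h1 : (ContinuousMap.id _).Homotopic f := by
    refine homotopic_of_global (fun z => z.2.bind fun x => dirac (C.H (z.1, x)))
      (continuous_bind_dirac C.H.continuous) (fun t μ hμ => (hH t μ hμ).mono (hHs t μ))
      (fun μ => ?_) fun μ => rfl
    simp [C.H_zero]
  have h2 : f.Homotopic ((ofSuspension hpq n).comp (C.toSuspension hpq n)) := by
    refine homotopic_of_global
      (fun z => mix z.1 (z.2.bind fun x => dirac (C.H (1, x)))
        (join p q (Set.projIcc 0 1 zero_le_one (C.height z.2)) (C.peel hpq z.2)))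
      (continuous_of_mk fun k => ?_) (fun t μ hμ => ?_) (fun μ => ?_) fun μ => ?_
    · have hF : Liftable fun z : unitInterval × (stdSimplex ℝ (Fin k) × (Fin k → X)) =>
        FormalBary.mk k z.2 := (liftable_mk k).comp continuous_snd
      exact ((hF.map (f := fun w => C.H (1, w.2)) (C.H.continuous.comp
        (continuous_const.prodMk continuous_snd))).mix
        ((hF.peel hpq).join (continuous_projIcc.comp
          (C.continuous_height.comp hF.continuous))) continuous_fst).continuous
    · refine (hH 1 μ hμ).mono fun x hx => ?_
      rcases Finset.mem_union.1 (points_mix_subset _ _ _ hx) with h | h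
      · exact hHs 1 μ h
      rcases mem_points_join h with h | ⟨rfl, h⟩ | ⟨rfl, h⟩
      · obtain ⟨y, hy, hyx, -⟩ := C.mem_points_peel hpq h
        exact Finset.mem_image.2 ⟨y, hy, hyx⟩
      -- If the height is less than `1 / 2`, there is mass near `p`.
      · refine Finset.mem_image.2 (C.mem_image_of_massLeft_pos fun h0 => ?_)
        have h3 := C.massRight_nonneg μ
        have h4 : (1 / 2 : ℝ) ≤ C.height μ := by unfold height; linarith
        have h5 : (1 / 2 : ℝ) ≤ Set.projIcc (0 : ℝ) 1 zero_le_one (C.height μ) := by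
          rw [Set.coe_projIcc]
          exact le_max_of_le_right (le_min (by norm_num) h4)
        exact absurd h (not_lt.2 h5)
      · refine Finset.mem_image.2 (C.mem_image_of_massRight_pos fun h0 => ?_)
        have h3 := C.massLeft_nonneg μ
        have h4 : C.height μ ≤ (1 / 2 : ℝ) := by unfold height; linarith
        have h5 : (Set.projIcc (0 : ℝ) 1 zero_le_one (C.height μ) : ℝ) ≤ 1 / 2 := by
          rw [Set.coe_projIcc]
          exact max_le (by norm_num) (min_le_of_right_le h4)
        exact absurd h (not_lt.2 h5)
    · exact mix_zero _ _
    · exact (mix_one _ _).trans (coe_ofSuspension_clamp hpq n (C.peel_mem hpq μ.2)).symm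
  exact (h1.trans h2).symm

/-- The key case distinction: if the collapsed `μ` already contains `p` or `q`, then adding both
of them does not leave `fiberBarySpace`. Otherwise `μ` has no mass near `p` and `q`, and
peeling removes exactly the point that was added by `join`. -/
theorem mix_peel_join_mem (hpq : p ≠ q) {n : ℕ} {μ : FormalBary X}
    (hμ : μ ∈ fiberBarySpace (mergePoint p q) n) (r s : unitInterval)
    (h0 : 0 ≤ C.height (join p q s μ)) (h1 : C.height (join p q s μ) ≤ 1) :
    mix r (C.peel hpq (join p q s μ)) (μ.bind fun x => dirac (C.H (1, x))) ∈
      fiberBarySpace (mergePoint p q) n := by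
  classical
  have hS : ((μ.points.image fun x => C.H (1, x)).image (mergePoint p q)).card ≤ n := by
    refine card_image_mergePoint_image_le (le_of_eq_of_le ?_ hμ) (C.H_left 1) (C.H_right 1)
    congr
  have hmix : ∀ x ∈ (mix r (C.peel hpq (join p q s μ))
      (μ.bind fun x => dirac (C.H (1, x)))).points,
      x ∈ (C.peel hpq (join p q s μ)).points ∨ x ∈ μ.points.image fun x => C.H (1, x) := by
    intro x hx
    rcases Finset.mem_union.1 (points_mix_subset _ _ _ hx) with h | h
    · exact Or.inl h
    · obtain ⟨y, hy, hxy⟩ := Finset.mem_biUnion.1 (points_bind_subset _ _ h)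
      rw [points_dirac, Finset.mem_singleton] at hxy
      exact Or.inr (Finset.mem_image.2 ⟨y, hy, hxy.symm⟩)
  by_cases hpS : p ∈ (μ.points.image fun x => C.H (1, x)) ∨
      q ∈ (μ.points.image fun x => C.H (1, x))
  · have := card_image_mergePoint_le_of_subset (T := (mix r (C.peel hpq (join p q s μ))
      (μ.bind fun x => dirac (C.H (1, x)))).points) (p := p) (q := q) (n := n)
      (S := μ.points.image fun x => C.H (1, x)) (by convert hS) (by convert hpS) ?_
    · exact this
    · intro x hx
      rcases hmix x hx with h | h
      · obtain ⟨y, hy, rfl, -⟩ := C.mem_points_peel hpq h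
        rcases mem_points_join hy with h | ⟨rfl, -⟩ | ⟨rfl, -⟩
        · simp only [Finset.mem_insert, Finset.mem_image]
          exact Or.inr (Or.inr ⟨y, h, rfl⟩)
        · simp [C.H_left]
        · simp [C.H_right]
      · simp only [Finset.mem_insert]
        exact Or.inr (Or.inr (by convert h))
  · have hφ : C.massLeft μ = 0 := by
      by_contra h
      exact hpS (Or.inl (Finset.mem_image.2 (C.mem_image_of_massLeft_pos h)))
    have hψ : C.massRight μ = 0 := by
      by_contra h
      exact hpS (Or.inr (Finset.mem_image.2 (C.mem_image_of_massRight_pos h)))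
    have h2 : C.massLeft (join p q s μ) = 0 ∨ C.massRight (join p q s μ) = 0 := by
      unfold massLeft at hφ ⊢
      unfold massRight at hψ ⊢
      rw [integral_eq_zero_iff _ fun _ => le_max_right _ _] at hφ hψ ⊢
      rw [integral_eq_zero_iff _ fun _ => le_max_right _ _]
      rcases le_or_gt (s : ℝ) (1 / 2) with h | h
      · refine Or.inr fun x hx => ?_
        rcases mem_points_join hx with h' | ⟨rfl, -⟩ | ⟨-, h'⟩
        · exact hψ x h'
        · exact max_eq_right (C.ψ_left_neg hpq).le
        · exact absurd h' (not_lt.2 h)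
      · refine Or.inl fun x hx => ?_
        rcases mem_points_join hx with h' | ⟨-, h'⟩ | ⟨rfl, -⟩
        · exact hφ x h'
        · exact absurd h' (not_lt.2 h.le)
        · exact max_eq_right (not_le.1 (C.φ_right_neg hpq)).le
    have h3 := C.fraction_eq_one h2 (C.abs_sub_le_of_height h0 h1)
    refine mem_fiberBarySpace_of_points (S := μ.points.image fun x => C.H (1, x))
      (fun x hx => ?_) (by convert hS)
    rcases hmix x hx with h | h
    · obtain ⟨y, hy, hyx, hf⟩ := C.mem_points_peel hpq h
      rcases mem_points_join hy with h | h | h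
      · exact Finset.mem_image.2 ⟨y, h, hyx⟩
      · exact absurd h.1 (hf h3).1
      · exact absurd h.1 (hf h3).2
    · convert h

section Return

variable (n : ℕ)

/-- The height of the point `join p q s μ` as a function on the cylinder. -/
def joinHeight (w : fiberBarySpace (mergePoint p q) n × unitInterval) : ℝ :=
  C.height (join p q w.2 w.1)

theorem continuous_joinHeight : Continuous (C.joinHeight n) := by
  have h : Continuous fun w : fiberBarySpace (mergePoint p q) n × unitInterval =>
      (w.2, (w.1 : FormalBary X)) :=
    continuous_snd.prodMk (continuous_subtype_val.comp continuous_fst)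
  have h' := (C.continuous_height.comp (continuous_join (p := p) (q := q))).comp h
  exact h'

theorem joinHeight_zero (hpq : p ≠ q) (d : fiberBarySpace (mergePoint p q) n) :
    C.joinHeight n (d, 0) ≤ 0 := by
  simp only [joinHeight, join_zero, C.height_dirac_left hpq]; norm_num

theorem joinHeight_one (hpq : p ≠ q) (d : fiberBarySpace (mergePoint p q) n) :
    1 ≤ C.joinHeight n (d, 1) := by
  simp only [joinHeight, join_one, C.height_dirac_right hpq]; norm_num

theorem continuous_cylinder_val {A : Type*} [TopologicalSpace A] {D : Set A} :
    Continuous fun z : unitInterval × (D × unitInterval) => (z.2.1 : A) :=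
  continuous_subtype_val.comp (continuous_fst.comp continuous_snd)

/-- The self-map of the suspension that applies the deformation at time `t` and changes heights as
the composite of `ofSuspension` and `toSuspension` does. -/
def suspensionMap (hpq : p ≠ q) (t : unitInterval) :
    C(Suspension (fiberBarySpace (mergePoint p q) n),
      Suspension (fiberBarySpace (mergePoint p q) n)) :=
  ⟨Suspension.lift (fun w => Suspension.clamp _ ((w.1 : FormalBary X).bind
      fun x => dirac (C.H (t, x))) (C.joinHeight n w)) (Suspension.pole _)
      (fun d => Suspension.clamp_of_nonpos _ (C.joinHeight_zero n hpq d))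
      (fun d => Suspension.clamp_of_one_le _ (C.joinHeight_one n hpq d)),
    Suspension.continuous_lift (Suspension.continuous_clamp ((continuous_map_dirac
      (C.H.continuous.comp (Continuous.prodMk_right t))).comp
        (continuous_subtype_val.comp continuous_fst)) (C.continuous_joinHeight n)
        fun w _ _ => C.bind_H_mem_fiberBarySpace t w.1.2) _ _⟩

theorem toSuspension_ofSuspension_pole (hpq : p ≠ q) (b : Bool) :
    C.toSuspension hpq n (ofSuspension hpq n (Suspension.pole _ b)) = Suspension.pole _ b := by
  change Suspension.clamp _ (C.peel hpq (dirac (cond b q p))) (C.height (dirac (cond b q p))) = _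
  cases b
  · refine Suspension.clamp_of_nonpos _ ?_
    rw [cond_false, C.height_dirac_left hpq]; norm_num
  · refine Suspension.clamp_of_one_le _ ?_
    rw [cond_true, C.height_dirac_right hpq]; norm_num

theorem continuous_mix_peel_join (hpq : p ≠ q) :
    Continuous fun z : (unitInterval × unitInterval) × FormalBary X =>
      mix z.1.1 (C.peel hpq (join p q z.1.2 z.2)) (z.2.bind fun x => dirac (C.H (1, x))) := by
  refine continuous_of_mk fun k => ?_
  have hF : Liftable fun z : (unitInterval × unitInterval) ×
    (stdSimplex ℝ (Fin k) × (Fin k → X)) => FormalBary.mk k z.2 :=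
    (liftable_mk k).comp continuous_snd
  exact (((hF.join (continuous_snd.comp continuous_fst)).peel hpq).mix
    (hF.map (f := fun w => C.H (1, w.2)) (C.H.continuous.comp
      (continuous_const.prodMk continuous_snd)))
    (continuous_fst.comp continuous_fst)).continuous

/-- The homotopy runs along the line segments from peeled to collapsed barycenters. -/
theorem comp_homotopic_suspensionMap_one (hpq : p ≠ q) :
    ((C.toSuspension hpq n).comp (ofSuspension hpq n)).Homotopic (C.suspensionMap n hpq 1) := by
  have h : Continuous fun z : unitInterval × (fiberBarySpace (mergePoint p q) n × unitInterval) =>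
      ((z.1, z.2.2), (z.2.1 : FormalBary X)) :=
    (continuous_fst.prodMk (continuous_snd.comp continuous_snd)).prodMk continuous_cylinder_val
  have hF := (C.continuous_mix_peel_join hpq).comp h
  refine Suspension.homotopic_of_clamp
    (F := fun z => mix z.1 (C.peel hpq (join p q z.2.2 z.2.1))
      ((z.2.1 : FormalBary X).bind fun x => dirac (C.H (1, x))))
    (k := fun z => C.joinHeight n z.2)
    hF ((C.continuous_joinHeight n).comp continuous_snd)
    (fun z h0 h1 => C.mix_peel_join_mem hpq z.2.1.2 _ _ h0 h1)
    (fun _ => C.joinHeight_zero n hpq) (fun _ => C.joinHeight_one n hpq)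
    (fun d s => ?_) (fun d s => ?_) (C.toSuspension_ofSuspension_pole n hpq) fun b => rfl
  · simp only [mix_zero]; rfl
  · simp only [mix_one]; rfl

theorem suspensionMap_homotopic (hpq : p ≠ q) :
    (C.suspensionMap n hpq 0).Homotopic (C.suspensionMap n hpq 1) := by
  have h : Continuous fun z : unitInterval × (fiberBarySpace (mergePoint p q) n × unitInterval) =>
      (z.1, (z.2.1 : FormalBary X)) := continuous_fst.prodMk continuous_cylinder_val
  have hF := (continuous_bind_dirac C.H.continuous).comp h
  exact Suspension.homotopic_of_clamp
    (F := fun z => (z.2.1 : FormalBary X).bind fun x => dirac (C.H (z.1, x)))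
    (k := fun z => C.joinHeight n z.2)
    hF ((C.continuous_joinHeight n).comp continuous_snd)
    (fun z _ _ => C.bind_H_mem_fiberBarySpace _ z.2.1.2)
    (fun _ => C.joinHeight_zero n hpq) (fun _ => C.joinHeight_one n hpq)
    (fun _ _ => rfl) (fun _ _ => rfl) (fun _ => rfl) fun _ => rfl

theorem suspensionMap_zero_homotopic_id (hpq : p ≠ q) :
    (C.suspensionMap n hpq 0).Homotopic (ContinuousMap.id _) := by
  refine Suspension.homotopic_of_clamp (F := fun z => (z.2.1 : FormalBary X))
    (k := fun z => (1 - (z.1 : ℝ)) * C.joinHeight n z.2 + z.1 * z.2.2) continuous_cylinder_val ?_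
    (fun z _ _ => z.2.1.2) (fun r d => ?_) (fun r d => ?_)
    (fun d s => ?_) (fun d s => ?_) (fun b => rfl) fun b => rfl
  · have h : Continuous fun z : unitInterval ×
        (fiberBarySpace (mergePoint p q) n × unitInterval) => (z.1 : ℝ) :=
      continuous_subtype_val.comp continuous_fst
    exact ((continuous_const.sub h).mul ((C.continuous_joinHeight n).comp continuous_snd)).add
      (h.mul (continuous_subtype_val.comp (continuous_snd.comp continuous_snd)))
  · have := mul_nonneg (sub_nonneg.2 r.2.2) (neg_nonneg.2 (C.joinHeight_zero n hpq d))
    simp only [Set.Icc.coe_zero, mul_zero, add_zero]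
    linarith
  · have := mul_le_mul_of_nonneg_left (C.joinHeight_one n hpq d) (sub_nonneg.2 r.2.2)
    simp only [Set.Icc.coe_one, mul_one] at this ⊢
    linarith
  · change Suspension.clamp _ ((d : FormalBary X).bind fun x => dirac (C.H (0, x)))
      (C.joinHeight n (d, s)) = _
    simp [C.H_zero]
  · have h : (1 - ((1 : unitInterval) : ℝ)) * C.joinHeight n (d, s) + (1 : unitInterval) * s
        = s := by simp
    rw [ContinuousMap.id_apply]
    simp only [h]
    exact (Suspension.clamp_of_mem d.2 s.2).symm

theorem toSuspension_comp_ofSuspension_homotopic (hpq : p ≠ q) :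
    ((C.toSuspension hpq n).comp (ofSuspension hpq n)).Homotopic (ContinuousMap.id _) :=
  (C.comp_homotopic_suspensionMap_one n hpq).trans
    ((C.suspensionMap_homotopic n hpq).symm.trans (C.suspensionMap_zero_homotopic_id n hpq))

end Return

/-- The space `pairBarySpace p q n` is the union of two subspaces that are star-shaped about `p`
and `q`, and it has the homotopy type of the suspension of their intersection. -/
def pairBarySpaceEquiv (hpq : p ≠ q) (n : ℕ) :
    pairBarySpace p q n ≃ₕ Suspension (fiberBarySpace (mergePoint p q) n) where
  toFun := C.toSuspension hpq n
  invFun := ofSuspension hpq n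
  left_inv := C.ofSuspension_comp_toSuspension_homotopic hpq n
  right_inv := C.toSuspension_comp_ofSuspension_homotopic n hpq

end PairCollapse

/-! ### Weights -/

section Weights

open Classical

variable {X : Type*} {p₁ p₂ : X} {w₁ w₂ ε : ℝ} {n : ℕ}

theorem sum_twoPointWeight (hp : p₁ ≠ p₂) (w₁ w₂ : ℝ) (S : Finset X) :
    ∑ x ∈ S, twoPointWeight p₁ p₂ w₁ w₂ x =
      (S \ {p₁, p₂}).card + (if p₁ ∈ S then w₁ else 0) + (if p₂ ∈ S then w₂ else 0) := by
  have h : ∀ x, twoPointWeight p₁ p₂ w₁ w₂ x = (if x ∉ ({p₁, p₂} : Finset X) then 1 else 0) +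
      (if x = p₁ then w₁ else 0) + (if x = p₂ then w₂ else 0) := by
    intro x
    unfold twoPointWeight
    by_cases h1 : x = p₁
    · subst h1; simp [hp]
    · by_cases h2 : x = p₂ <;> simp [h1, h2, hp.symm]
  simp only [h, Finset.sum_add_distrib, Finset.sum_ite_eq', Finset.sum_boole,
    ← Finset.sdiff_eq_filter]

theorem card_eq_card_sdiff_pair (hp : p₁ ≠ p₂) (S : Finset X) :
    S.card = (S \ {p₁, p₂}).card + (if p₁ ∈ S then 1 else 0) + (if p₂ ∈ S then 1 else 0) := by
  have h : ∀ x, twoPointWeight p₁ p₂ 1 1 x = 1 := fun x => by simp [twoPointWeight]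
  have h1 := sum_twoPointWeight hp 1 1 S
  simp only [h, Finset.sum_const, nsmul_eq_mul, mul_one] at h1
  exact_mod_cast h1

theorem mem_weightedBarySpace_iff (hp : p₁ ≠ p₂) (w₁ w₂ ρ : ℝ) (μ : FormalBary X) :
    μ ∈ weightedBarySpace (twoPointWeight p₁ p₂ w₁ w₂) ρ ↔
      (μ.points \ {p₁, p₂}).card + (if p₁ ∈ μ.points then w₁ else 0) +
        (if p₂ ∈ μ.points then w₂ else 0) ≤ ρ := by
  rw [← sum_twoPointWeight hp]; rfl

/-- If `m` is the largest natural number with `m + w ≤ n + ε`, then `k + w ≤ n + ε` means `k ≤ m`.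
-/
theorem natCast_add_le_iff {a w : ℝ} {k m : ℕ} (h0 : (m : ℝ) + w ≤ n + ε)
    (h1 : (n : ℝ) + ε < m + 1 + w) (ha : a = k + w) : a ≤ n + ε ↔ k ≤ m := by
  subst ha
  constructor
  · intro h
    have : (k : ℝ) < m + 1 := by linarith
    exact Nat.lt_succ_iff.1 (by exact_mod_cast this)
  · intro h
    have : (k : ℝ) ≤ m := by exact_mod_cast h
    linarith

theorem weightedBarySpace_eq_pairBarySpace (hp : p₁ ≠ p₂) (h1 : ε < 1)
    (hw₁ : 0 < w₁) (hw₂ : 0 < w₂) (h₁ : w₁ ≤ ε) (h₂ : w₂ ≤ ε) (h : ε < w₁ + w₂) :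
    weightedBarySpace (twoPointWeight p₁ p₂ w₁ w₂) (n + ε) = pairBarySpace p₁ p₂ n := by
  ext μ
  rw [mem_weightedBarySpace_iff hp]
  change _ ↔ PairAdmissible p₁ p₂ n μ.points
  unfold PairAdmissible
  generalize (μ.points \ {p₁, p₂}).card = k
  by_cases hm₁ : p₁ ∈ μ.points <;> by_cases hm₂ : p₂ ∈ μ.points <;>
    simp only [hm₁, hm₂, if_true, if_false, true_implies, false_implies, and_true]
  · refine ⟨fun h' => ?_, fun h' => ?_⟩
    · have : (k : ℝ) < n := by linarith
      have : k < n := by exact_mod_cast this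
      omega
    · have : (k : ℝ) + 1 ≤ n := by exact_mod_cast h'.2
      linarith
  · exact natCast_add_le_iff (w := w₁) (by linarith) (by linarith) (by ring)
  · exact natCast_add_le_iff (w := w₂) (by linarith) (by linarith) (by ring)
  · exact natCast_add_le_iff (w := 0) (by linarith) (by linarith) (by ring)

theorem weightedBarySpace_eq_fiberBarySpace (hp : p₁ ≠ p₂) (h0 : 0 ≤ ε)
    (h₁ : ε < w₁) (h₂ : ε < w₂) (h : w₁ + w₂ ≤ 1 + ε) :
    weightedBarySpace (twoPointWeight p₁ p₂ w₁ w₂) (n + ε) =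
      fiberBarySpace (mergePoint p₁ p₂) n := by
  ext μ
  rw [mem_weightedBarySpace_iff hp]
  refine Iff.trans ?_ card_image_mergePoint_le_iff.symm
  generalize (μ.points \ {p₁, p₂}).card = k
  have key : ∀ w : ℝ, ε < w → w ≤ 1 + ε → ((k : ℝ) + w ≤ n + ε ↔ k + 1 ≤ n) := by
    intro w hw hw'
    refine ⟨fun h' => ?_, fun h' => ?_⟩
    · have : (k : ℝ) < n := by linarith
      exact_mod_cast this
    · have : (k : ℝ) + 1 ≤ n := by exact_mod_cast h'
      linarith
  by_cases hm₁ : p₁ ∈ μ.points <;> by_cases hm₂ : p₂ ∈ μ.points <;>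
    simp only [hm₁, hm₂, if_true, if_false, true_or, or_true, or_self, true_implies,
      false_implies, and_true, add_zero]
  · rw [add_assoc, key _ (by linarith) h]; omega
  · rw [key _ h₁ (by linarith)]; omega
  · rw [key _ h₂ (by linarith)]; omega
  · exact natCast_add_le_iff (w := 0) (by linarith) (by linarith) (by ring)

theorem weightedBarySpace_eq_barySpace (hp : p₁ ≠ p₂) (h0 : 0 ≤ ε) (h1 : ε < 1)
    (hw₁ : w₁ ≤ 1) (hw₂ : w₂ ≤ 1) (h : 1 + ε < w₁ + w₂) :
    weightedBarySpace (twoPointWeight p₁ p₂ w₁ w₂) (n + ε) = barySpace X n := by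
  ext μ
  rw [mem_weightedBarySpace_iff hp]
  change _ ↔ μ.points.card ≤ n
  rw [card_eq_card_sdiff_pair hp μ.points]
  generalize (μ.points \ {p₁, p₂}).card = k
  by_cases hm₁ : p₁ ∈ μ.points <;> by_cases hm₂ : p₂ ∈ μ.points <;>
    simp only [hm₁, hm₂, if_true, if_false]
  · exact natCast_add_le_iff (w := w₁ + w₂ - 2) (by linarith) (by linarith) (by push_cast; ring)
  · exact natCast_add_le_iff (w := w₁ - 1) (by linarith) (by linarith) (by push_cast; ring)
  · exact natCast_add_le_iff (w := w₂ - 1) (by linarith) (by linarith) (by push_cast; ring)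
  · exact natCast_add_le_iff (w := 0) (by linarith) (by linarith) (by push_cast; ring)

/-- If `p₁` can be added to every admissible set of points, then line segments to `p₁` contract the
space. -/
theorem contractibleSpace_weightedBarySpace [TopologicalSpace X] (hp : p₁ ≠ p₂) (h1 : ε < 1)
    (hw₁ : 0 < w₁) (hw₂ : 0 < w₂) (hw₂' : w₂ ≤ 1) (h₁ : w₁ ≤ ε) (h : w₁ + w₂ ≤ ε ∨ ε < w₂) :
    ContractibleSpace (weightedBarySpace (twoPointWeight p₁ p₂ w₁ w₂) (n + ε)) := by
  have hpos : ∀ x, 0 ≤ twoPointWeight p₁ p₂ w₁ w₂ x := fun x => by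
    unfold twoPointWeight; split_ifs <;> linarith
  refine contractibleSpace_of_starShaped (p := p₁) ?_ fun c μ hμ => ?_
  · rw [mem_weightedBarySpace_iff hp]
    have : ({p₁} : Finset X) \ {p₁, p₂} = ∅ := by simp [Finset.sdiff_eq_empty_iff_subset]
    simp only [FormalBary.points_dirac, this, Finset.card_empty, Finset.mem_singleton, if_true,
      hp.symm, if_false]
    have := Nat.cast_nonneg (α := ℝ) n
    push_cast
    linarith
  · change ∑ x ∈ (FormalBary.mix c μ (FormalBary.dirac p₁)).points,
      twoPointWeight p₁ p₂ w₁ w₂ x ≤ _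
    refine (Finset.sum_le_sum_of_subset_of_nonneg (t := insert p₁ μ.points) (fun x hx => ?_)
      fun x _ _ => hpos x).trans ?_
    · have := FormalBary.points_mix_subset _ _ _ hx
      simpa [or_comm] using this
    · rw [sum_twoPointWeight hp]
      rw [mem_weightedBarySpace_iff hp] at hμ
      have h2 : insert p₁ μ.points \ {p₁, p₂} ⊆ μ.points \ {p₁, p₂} :=
        sdiff_pair_subset_of_subset_insert (Or.inl rfl) subset_rfl
      have h3 : ((insert p₁ μ.points \ {p₁, p₂}).card : ℝ) ≤ (μ.points \ {p₁, p₂}).card := by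
        exact_mod_cast Finset.card_le_card h2
      have h4 : p₂ ∈ insert p₁ μ.points ↔ p₂ ∈ μ.points := by simp [hp.symm]
      simp only [Finset.mem_insert_self, if_true, h4]
      generalize (insert p₁ μ.points \ {p₁, p₂}).card = l at h3 ⊢
      generalize (μ.points \ {p₁, p₂}).card = k at h3 hμ
      by_cases hm₁ : p₁ ∈ μ.points
      · rw [if_pos hm₁] at hμ
        linarith
      rw [if_neg hm₁] at hμ
      by_cases hm₂ : p₂ ∈ μ.points
      · rw [if_pos hm₂] at hμ ⊢
        rcases h with h | h
        · have : (k : ℝ) < n + 1 := by linarith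
          have : k < n + 1 := by exact_mod_cast this
          have : (k : ℝ) ≤ n := by exact_mod_cast Nat.lt_succ_iff.1 this
          linarith
        · have : (k : ℝ) < n := by linarith
          have : k < n := by exact_mod_cast this
          have : (k : ℝ) + 1 ≤ n := by exact_mod_cast this
          linarith
      · rw [if_neg hm₂] at hμ ⊢
        have : (k : ℝ) < n + 1 := by linarith
        have : k < n + 1 := by exact_mod_cast this
        have : (k : ℝ) ≤ n := by exact_mod_cast Nat.lt_succ_iff.1 this
        linarith

end Weights

/-- An arc attached at two points of a path-connected space may be replaced by a circle attached at
an arbitrary base point. -/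
theorem nonempty_fiberBarySpace_equiv_wedge {X : Type*} [TopologicalSpace X]
    [PathConnectedSpace X] {p q : X} (hpq : p ≠ q) (C : PairCollapse p q) (x₀ : X) (n : ℕ) :
    Nonempty (fiberBarySpace (mergePoint p q) n ≃ₕ barySpace (Wedge x₀ (1 : Circle)) n) :=
  ⟨(C.fiberBarySpaceEquiv hpq (PathConnectedSpace.somePath p q) n).trans
    (barySpaceEquiv ((ArcAttach.slideEquiv (PathConnectedSpace.somePath p x₀)
      (PathConnectedSpace.somePath q x₀)).trans
        (ArcAttach.wedgeCircle x₀).toHomotopyEquiv) n)⟩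

end

theorem proposition6p1 {X : Type*} [TopologicalSpace X] [T2Space X] [ConnectedSpace X]
    (p₁ p₂ : X) (hp : p₁ ≠ p₂) (w₁ w₂ : ℝ) (hw₁ : 0 < w₁) (hw₁₂ : w₁ ≤ w₂) (hw₂ : w₂ ≤ 1)
    (ρ : ℝ) (hρ : 0 < ρ) (n : ℕ) (ε : ℝ) (hn : n = ⌊ρ⌋₊) (hε : ρ = n + ε) :
    (w₁ + w₂ ≤ ε →
      ContractibleSpace (weightedBarySpace (twoPointWeight p₁ p₂ w₁ w₂) ρ)) ∧
    (w₁ ≤ ε → w₂ ≤ ε → ε < w₁ + w₂ →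
      PathConnectedSpace X → IsNondegeneratePoint p₁ → IsNondegeneratePoint p₂ → ∀ x₀ : X,
      Nonempty (weightedBarySpace (twoPointWeight p₁ p₂ w₁ w₂) ρ ≃ₕ
        Suspension (barySpace (Wedge x₀ (1 : Circle)) n))) ∧
    (w₁ ≤ ε → ε < w₂ →
      ContractibleSpace (weightedBarySpace (twoPointWeight p₁ p₂ w₁ w₂) ρ)) ∧
    (ε < w₁ → ε < w₂ → w₁ + w₂ ≤ 1 + ε →
      PathConnectedSpace X → IsNondegeneratePoint p₁ → IsNondegeneratePoint p₂ → ∀ x₀ : X,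
      Nonempty (weightedBarySpace (twoPointWeight p₁ p₂ w₁ w₂) ρ ≃ₕ
        barySpace (Wedge x₀ (1 : Circle)) n)) ∧
    (1 + ε < w₁ + w₂ →
      Nonempty (weightedBarySpace (twoPointWeight p₁ p₂ w₁ w₂) ρ ≃ₕ barySpace X n)) ∧
    ((w₁ + w₂ ≤ ε) ∨ (w₁ ≤ ε ∧ w₂ ≤ ε ∧ ε < w₁ + w₂) ∨ (w₁ ≤ ε ∧ ε < w₂) ∨
      (ε < w₁ ∧ ε < w₂ ∧ w₁ + w₂ ≤ 1 + ε) ∨ (1 + ε < w₁ + w₂)) := by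

  have hε0 : 0 ≤ ε := by
    have := Nat.floor_le hρ.le
    rw [← hn] at this
    linarith
  have hε1 : ε < 1 := by
    have := Nat.lt_floor_add_one ρ
    rw [← hn] at this
    linarith
  have hw₂0 : 0 < w₂ := hw₁.trans_le hw₁₂
  rw [hε]
  refine ⟨fun h => ?_, fun h₁ h₂ h hX hp₁ hp₂ x₀ => ?_, fun h₁ h₂ => ?_,
    fun h₁ h₂ h hX hp₁ hp₂ x₀ => ?_, fun h => ?_, ?_⟩
  · exact contractibleSpace_weightedBarySpace hp hε1 hw₁ hw₂0 hw₂ (by linarith) (Or.inl h)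
  · rw [weightedBarySpace_eq_pairBarySpace hp hε1 hw₁ hw₂0 h₁ h₂ h]
    obtain ⟨C⟩ := exists_pairCollapse hp hp₁ hp₂
    obtain ⟨e⟩ := nonempty_fiberBarySpace_equiv_wedge hp C x₀ n
    exact ⟨(C.pairBarySpaceEquiv hp n).trans (Suspension.equiv e)⟩
  · exact contractibleSpace_weightedBarySpace hp hε1 hw₁ hw₂0 hw₂ h₁ (Or.inr h₂)
  · rw [weightedBarySpace_eq_fiberBarySpace hp hε0 h₁ h₂ h]
    obtain ⟨C⟩ := exists_pairCollapse hp hp₁ hp₂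
    exact nonempty_fiberBarySpace_equiv_wedge hp C x₀ n
  · rw [weightedBarySpace_eq_barySpace hp hε0 hε1 (hw₁₂.trans hw₂) hw₂ h]
    exact ⟨ContinuousMap.HomotopyEquiv.refl _⟩
  · rcases le_or_gt w₁ ε with h₁ | h₁
    · rcases le_or_gt w₂ ε with h₂ | h₂
      · rcases le_or_gt (w₁ + w₂) ε with h | h
        exacts [Or.inl h, Or.inr (Or.inl ⟨h₁, h₂, h⟩)]
      · exact Or.inr (Or.inr (Or.inl ⟨h₁, h₂⟩))
    · rcases le_or_gt (w₁ + w₂) (1 + ε) with h | h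
      · exact Or.inr (Or.inr (Or.inr (Or.inl ⟨h₁, h₁.trans_le hw₁₂, h⟩)))
      · exact Or.inr (Or.inr (Or.inr (Or.inr h)))
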